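/- Let $d\ge 1$, and let $\mathcal C^{(d)}$ be the space of non-empty compact subsets of $\mathbb R^d$ with the Hausdorff metric and its Borel $\sigma$-field. Let $\mathbf N$ be the set of measures $\xi$ on $\mathcal C^{(d)}$ with values in $\mathbb N_0\cup\{\infty\}$ that are finite on all balls, ordered by $\xi\le\xi'$ iff $\xi(A)\le\xi'(A)$ for all measurable $A$, with the smallest $\sigma$-field $\mathcal N$ that makes all maps $\xi\mapsto\xi(A)$, $A$ measurable, measurable. For probability measures on $\mathbf N$ write $P_1\overset{d}{\le}P_2$ (stochastic domination) if $P_1(E)\le P_2(E)$ for every increasing $E\in\mathcal N$, that is, every $E\in\mathcal N$ such that $\xi\in E$ and $\xi\le\xi'$ imply $\xi'\in E$. Let $\mathbb Q$ be a probability measure on $\mathcal C^{(d)}$ such that, for some $R>0$, $\mathbb Q$-almost every $K$ is contained in the closed ball $B(\mathbf 0,R)$. Put $\mu:=\iint \mathbf 1\{K+x\in\cdot\}\,\mathbb Q(dK)\,dx$, let $\lambda>0$, and let $\Pi_{\lambda\mu}$ be a Poisson process on $\mathcal C^{(d)}$ with intensity measure $\lambda\mu$. Let $\kappa:\mathcal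 C^{(d)}\times\mathbf N\to[0,\infty)$ be measurable with $\kappa\le 1$, and let $\Xi$ be a Gibbs process with Papangelou intensity $\kappa$ and activity $\lambda$, that is, a random element of $\mathbf N$ such that $$\mathbb E\Big[\int f(K,\Xi-\delta_K)\,\Xi(dK)\Big]=\lambda\,\mathbb E\Big[\int f(K,\Xi)\,\kappa(K,\Xi)\,\mu(dK)\Big]$$ for all non-negative measurable functions $f$ on $\mathcal C^{(d)}\times\mathbf N$. For $p\in\mathbb N=\{1,2,\dots\}$ let $\xi^{(p)}$ be the restriction of the product measure $\xi^p$ to the set of $p$-tuples with pairwise distinct entries, and let $\alpha^{(p)}:=\mathbb E[\Xi^{(p)}]$ be the $p$-th factorial moment measure of $\Xi$. Let $(K_1,\dots,K_p)\mapsto\mathbb P_{K_1,\dots,K_p}$ be a version of the $p$-th Palm distributions of $\Xi$, that is, a probability kernel from $(\mathcal C^{(d)})^p$ to $\mathbf N$ such that $$\mathbb E\Big[\int f(K_1,\dots,K_p,\Xi)\,\Xi^{(p)}(d(K_1,\dots,K_p))\Big]=\iint f(K_1,\dots,K_p,\xi)\,\mathbb P_{K_1,\dots,K_p}(d\xi)\,\alpha^{(p)}(d(K_1,\dots,K_p))$$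 for all non-negative measurable $f$, and let the reduced Palm distribution $\mathbb P^{!}_{K_1,\dots,K_p}$ be the image of $\mathbb P_{K_1,\dots,K_p}$ under $\xi\mapsto\xi-\delta_{K_1}-\dots-\delta_{K_p}$. Then $\mathbb P(\Xi\in\cdot)\overset{d}{\le}\mathbb P(\Pi_{\lambda\mu}\in\cdot)$. Furthermore, for each $p\in\mathbb N$ and each such version of the Palm distributions, $\mathbb P^{!}_{K_1,\dots,K_p}\overset{d}{\le}\mathbb P(\Pi_{\lambda\mu}\in\cdot)$ for $\alpha^{(p)}$-a.e. $(K_1,\dots,K_p)$. -/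

import Mathlib

open MeasureTheory ProbabilityTheory TopologicalSpace
open scoped ENNReal NNReal

noncomputable section

namespace ParticleProcess

/-- Euclidean space `ℝ^d`. -/
abbrev Euc (d : ℕ) : Type := EuclideanSpace ℝ (Fin d)

/-- The space of particles: non-empty compact subsets of `ℝ^d`, with the Hausdorff metric. -/
abbrev Particle (d : ℕ) : Type := NonemptyCompacts (Euc d)

/-- The Borel `σ`-field of the Hausdorff metric. -/
instance instMeasurableSpaceParticle (d : ℕ) : MeasurableSpace (Particle d) :=
  borel (Particle d)

instance instBorelSpaceParticle (d : ℕ) : BorelSpace (Particle d) := ⟨rfl⟩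

/-- The translate `K + x = {y + x | y ∈ K}` of a particle. -/
def translate {d : ℕ} (K : Particle d) (x : Euc d) : Particle d :=
  NonemptyCompacts.map (fun y => y + x) (continuous_id.add continuous_const) K

/-- Measures on the space of particles that take values in `{0, 1, 2, …} ∪ {∞}` and are finite
on all balls of the Hausdorff metric. -/
def IsConf {d : ℕ} (ξ : Measure (Particle d)) : Prop :=
  (∀ A : Set (Particle d), MeasurableSet A → ∃ n : ℕ∞, ξ A = (n : ℝ≥0∞)) ∧
    ∀ (K : Particle d) (r : ℝ), ξ (Metric.closedBall K r) < ∞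

/-- The space `N` of particle configurations. Its `σ`-field (a subspace of Mathlib's `σ`-field on
measures) is the smallest one for which all evaluations `ξ ↦ ξ A`, with `A` measurable, are
measurable. Its order is `ξ ≤ ξ'` iff `ξ A ≤ ξ' A` for all measurable `A`. -/
abbrev Conf (d : ℕ) : Type := {ξ : Measure (Particle d) // IsConf ξ}

section Removal

variable {d : ℕ}

lemma dirac_le_iff (ξ : Measure (Particle d)) (K : Particle d) :
    Measure.dirac K ≤ ξ ↔ 1 ≤ ξ {K} := by
  constructor
  · intro h
    simpa using h {K}
  · intro h
    refine Measure.le_iff.2 fun A hA => ?_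
    by_cases hK : K ∈ A
    · simpa [hK] using h.trans (measure_mono (Set.singleton_subset_iff.2 hK))
    · simp [Measure.dirac_apply' K hA, hK]

/-- A point mass can only be removed where there is one: otherwise nothing happens. -/
lemma sub_dirac_of_eq_zero {ξ : Measure (Particle d)} {K : Particle d} (h : ξ {K} = 0) :
    ξ - Measure.dirac K = ξ := by
  refine le_antisymm Measure.sub_le ?_
  rw [Measure.sub_def]
  refine le_sInf fun τ hτ => Measure.le_iff.2 fun A hA => ?_
  have h1 : ξ A = ξ (A \ {K}) := (measure_sdiff_null h).symm
  have h2 : (Measure.dirac K : Measure (Particle d)) (A \ {K}) = 0 := by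
    rw [Measure.dirac_apply' K (hA.diff (measurableSet_singleton K))]
    simp
  calc ξ A = ξ (A \ {K}) := h1
    _ ≤ (τ + Measure.dirac K) (A \ {K}) := hτ _
    _ = τ (A \ {K}) := by simp [h2]
    _ ≤ τ A := measure_mono Set.sdiff_subset

lemma IsConf.eq_zero_or_one_le {ξ : Measure (Particle d)} (hξ : IsConf ξ) (K : Particle d) :
    ξ {K} = 0 ∨ 1 ≤ ξ {K} := by
  obtain ⟨n, hn⟩ := hξ.1 {K} (measurableSet_singleton K)
  rw [hn]
  rcases eq_or_ne n 0 with h | h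
  · left; simp [h]
  · right; exact_mod_cast Order.one_le_iff_pos.2 (pos_iff_ne_zero.2 h)

lemma IsConf.sub_dirac {ξ : Measure (Particle d)} (hξ : IsConf ξ) (K : Particle d) :
    IsConf (ξ - Measure.dirac K) := by
  refine ⟨fun A hA => ?_, fun L r => lt_of_le_of_lt (Measure.sub_le _) (hξ.2 L r)⟩
  rcases hξ.eq_zero_or_one_le K with h | h
  · rw [sub_dirac_of_eq_zero h]
    exact hξ.1 A hA
  · obtain ⟨n, hn⟩ := hξ.1 A hA
    rw [Measure.sub_apply hA ((dirac_le_iff ξ K).2 h), hn, Measure.dirac_apply' K hA]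
    by_cases hK : K ∈ A
    · exact ⟨n - 1, by simp [hK]⟩
    · exact ⟨n, by simp [hK]⟩

end Removal

/-- The configuration `ξ - δ_K`. -/
def erase {d : ℕ} (ξ : Conf d) (K : Particle d) : Conf d :=
  ⟨ξ.1 - Measure.dirac K, ξ.2.sub_dirac K⟩

/-- The configuration `ξ - δ_{K₁} - … - δ_{K_p}`. -/
def eraseAll {d p : ℕ} (ξ : Conf d) (K : Fin p → Particle d) : Conf d :=
  (List.ofFn K).foldl erase ξ

/-- The `m`-th factorial measure `ξ^{(m)}`: the product measure `ξ^m` restricted to tuples with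
pairwise different entries. -/
def factorialMeasure {d : ℕ} (m : ℕ) (ξ : Conf d) : Measure (Fin m → Particle d) :=
  (Measure.pi fun _ : Fin m => ξ.1).restrict {K | Function.Injective K}

/-- The measure `μ = ∬ 1{K + x ∈ ·} Q(dK) dx`. -/
def particleMeasure {d : ℕ} (Q : Measure (Particle d)) : Measure (Particle d) :=
  (Q.prod (volume : Measure (Euc d))).map fun q => translate q.1 q.2

section Processes

variable {d : ℕ} {Ω : Type*} [MeasurableSpace Ω]

/-- The `m`-th factorial moment measure `α^{(m)} = E[Ξ^{(m)}]`. -/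
def factorialMomentMeasure (P : Measure Ω) (Ξ : Ω → Conf d) (m : ℕ) :
    Measure (Fin m → Particle d) :=
  P.bind fun ω => factorialMeasure m (Ξ ω)

/-- `X` is a Poisson process with intensity measure `ν`: the number of points in a measurable set
`A` has the Poisson distribution with parameter `ν A` (it is a.s. infinite if `ν A = ∞`), and the
numbers of points in pairwise disjoint measurable sets are independent. -/
structure IsPoissonProcess (P : Measure Ω) (X : Ω → Conf d) (ν : Measure (Particle d)) : Prop where
  measurable : Measurable X
  count_of_ne_top : ∀ A : Set (Particle d), MeasurableSet A → ν A ≠ ∞ →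
    P.map (fun ω => (X ω).1 A) =
      (poissonMeasure (ν A).toNNReal).map (fun n : ℕ => (n : ℝ≥0∞))
  count_of_eq_top : ∀ A : Set (Particle d), MeasurableSet A → ν A = ∞ → ∀ᵐ ω ∂P, (X ω).1 A = ∞
  indep : ∀ (m : ℕ) (A : Fin m → Set (Particle d)), (∀ i, MeasurableSet (A i)) →
    Pairwise (fun i j => Disjoint (A i) (A j)) → iIndepFun (fun i ω => (X ω).1 (A i)) P

/-- `Ξ` is a Gibbs process with Papangelou intensity `κ` and activity `lam` with respect to `μ`:
a random configuration that satisfies the GNZ equation. -/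
structure IsGibbsProcess (P : Measure Ω) (Ξ : Ω → Conf d) (κ : Particle d × Conf d → ℝ≥0)
    (lam : ℝ≥0) (μ : Measure (Particle d)) : Prop where
  measurable : Measurable Ξ
  measurable_papangelou : Measurable κ
  gnz : ∀ f : Particle d × Conf d → ℝ≥0∞, Measurable f →
    ∫⁻ ω, ∫⁻ K, f (K, erase (Ξ ω) K) ∂(Ξ ω).1 ∂P =
      lam * ∫⁻ ω, ∫⁻ K, f (K, Ξ ω) * (κ (K, Ξ ω) : ℝ≥0∞) ∂μ ∂P

/-- `R K`, for `K = (K₁, …, K_p)`, is a version of the `p`-th Palm distributions of `Ξ`. -/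
def IsPalm (P : Measure Ω) (Ξ : Ω → Conf d) (p : ℕ)
    (R : Kernel (Fin p → Particle d) (Conf d)) : Prop :=
  IsMarkovKernel R ∧
    ∀ f : (Fin p → Particle d) × Conf d → ℝ≥0∞, Measurable f →
      ∫⁻ ω, ∫⁻ K, f (K, Ξ ω) ∂(factorialMeasure p (Ξ ω)) ∂P =
        ∫⁻ K, ∫⁻ ξ, f (K, ξ) ∂(R K) ∂(factorialMomentMeasure P Ξ p)

end Processes

/-- The reduced Palm distribution at `K = (K₁, …, K_p)`: the image of the Palm distribution at `K`
under `ξ ↦ ξ - δ_{K₁} - … - δ_{K_p}`. -/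
def reducedPalm {d p : ℕ} (R : Kernel (Fin p → Particle d) (Conf d)) (K : Fin p → Particle d) :
    Measure (Conf d) :=
  (R K).map fun ξ => eraseAll ξ K

/-- Stochastic domination of distributions on `N`: `P₁ E ≤ P₂ E` for each increasing measurable
event `E`. -/
def StochDominated {d : ℕ} (P₁ P₂ : Measure (Conf d)) : Prop :=
  ∀ E : Set (Conf d), MeasurableSet E → IsUpperSet E → P₁ E ≤ P₂ E

/-! The maps used in the definitions above are measurable, so that no image measure and no mixture
of measures there is degenerate. -/

lemma measurable_translate {d : ℕ} :
    Measurable fun q : Particle d × Euc d => translate q.1 q.2 := by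
  have h : Continuous fun q : Particle d × Euc d => translate q.1 q.2 := by
    have h1 : (fun q : Particle d × Euc d => translate q.1 q.2) = fun q =>
        NonemptyCompacts.map (fun p : Euc d × Euc d => p.1 + p.2) continuous_add
          (q.1 ×ˢ ({q.2} : Particle d)) := by
      funext q
      refine SetLike.coe_injective ?_
      simp [ParticleProcess.translate, NonemptyCompacts.coe_map, Set.prod_singleton,
        Set.image_image]
    rw [h1]
    fun_prop
  exact h.measurable

lemma measurable_erase {d : ℕ} (K : Particle d) : Measurable fun ξ : Conf d => erase ξ K := by
  refine Measurable.subtype_mk (Measure.measurable_of_measurable_coe _ fun A hA => ?_)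
  have h0 : ∀ B : Set (Particle d), MeasurableSet B → Measurable fun ξ : Conf d => ξ.1 B :=
    fun B hB => (Measure.measurable_coe hB).comp measurable_subtype_coe
  have h : (fun ξ : Conf d => (ξ.1 - Measure.dirac K) A) = fun ξ : Conf d =>
      if ξ.1 {K} = 0 then ξ.1 A else ξ.1 A - Measure.dirac K A := by
    funext ξ
    split_ifs with h
    · rw [sub_dirac_of_eq_zero h]
    · exact Measure.sub_apply hA
        ((dirac_le_iff ξ.1 K).2 ((ξ.2.eq_zero_or_one_le K).resolve_left h))
  rw [h]
  exact Measurable.ite (h0 {K} (measurableSet_singleton K) (measurableSet_singleton 0))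
    (h0 A hA) ((h0 A hA).sub measurable_const)

lemma measurable_eraseAll {d p : ℕ} (K : Fin p → Particle d) :
    Measurable fun ξ : Conf d => eraseAll ξ K := by
  unfold eraseAll
  generalize List.ofFn K = l
  induction l with
  | nil => exact measurable_id
  | cons a l ih => exact ih.comp (measurable_erase a)

lemma isConf_sigmaFinite {d : ℕ} (ξ : Conf d) : SigmaFinite ξ.1 := by
  obtain ⟨K⟩ : Nonempty (Particle d) := inferInstance
  exact ⟨⟨⟨fun n : ℕ => Metric.closedBall K n, fun _ => trivial, fun n => ξ.2.2 K n,
    Metric.iUnion_closedBall_nat K⟩⟩⟩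

lemma measurable_factorialMeasure {d : ℕ} (m : ℕ) :
    Measurable (factorialMeasure m : Conf d → Measure (Fin m → Particle d)) := by
  have hinj : MeasurableSet {K : Fin m → Particle d | Function.Injective K} := by
    have : {K : Fin m → Particle d | Function.Injective K} =
        ⋂ i, ⋂ j, {K | K i = K j → i = j} := by
      ext K; simp [Function.Injective]
    rw [this]
    refine MeasurableSet.iInter fun i => MeasurableSet.iInter fun j => ?_
    by_cases h : i = j
    · simp [h]
    · simp only [h, imp_false]
      exact (measurableSet_eq_fun (measurable_pi_apply i) (measurable_pi_apply j)).compl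
  have hpi : Measurable fun ξ : Conf d => Measure.pi fun _ : Fin m => ξ.1 := by
    obtain ⟨L⟩ : Nonempty (Particle d) := inferInstance
    have key : ∀ n : ℕ, Measurable fun ξ : Conf d =>
        Measure.pi fun _ : Fin m => ξ.1.restrict (Metric.closedBall L n) := by
      intro n
      have : ∀ ξ : Conf d, IsFiniteMeasure (ξ.1.restrict (Metric.closedBall L n)) :=
        fun ξ => ⟨by simpa using ξ.2.2 L n⟩
      refine Measurable.measure_of_isPiSystem generateFrom_pi.symm isPiSystem_pi ?_ ?_
      · rintro _ ⟨s, hs, rfl⟩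
        simp only [Measure.pi_pi]
        refine Finset.measurable_prod _ fun i _ => ?_
        have hsi : MeasurableSet (s i) := hs i (Set.mem_univ i)
        simp only [Measure.restrict_apply hsi]
        exact (Measure.measurable_coe
          (hsi.inter Metric.isClosed_closedBall.measurableSet)).comp measurable_subtype_coe
      · simp only [Measure.pi_univ, Measure.restrict_apply_univ]
        exact Finset.measurable_prod _ fun i _ => (Measure.measurable_coe
          Metric.isClosed_closedBall.measurableSet).comp measurable_subtype_coe
    refine Measure.measurable_of_measurable_coe _ fun A hA => ?_
    have : (fun ξ : Conf d => (Measure.pi fun _ : Fin m => ξ.1) A) = fun ξ : Conf d =>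
        ⨆ n : ℕ, (Measure.pi fun _ : Fin m => ξ.1.restrict (Metric.closedBall L n)) A := by
      funext ξ
      have := isConf_sigmaFinite ξ
      have hmono : Monotone fun n : ℕ => A ∩ Set.univ.pi fun _ : Fin m =>
          Metric.closedBall L (n : ℝ) := fun a b hab => Set.inter_subset_inter_right _
            (Set.pi_mono fun _ _ => Metric.closedBall_subset_closedBall (by exact_mod_cast hab))
      have hun : A = ⋃ n : ℕ, A ∩ Set.univ.pi fun _ : Fin m => Metric.closedBall L (n : ℝ) := by
        rw [← Set.inter_iUnion]
        refine (Set.inter_eq_left.2 fun K _ => ?_).symm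
        obtain ⟨n, hn⟩ := exists_nat_ge (∑ i, dist (K i) L)
        refine Set.mem_iUnion.2 ⟨n, fun i _ => ?_⟩
        exact (Finset.single_le_sum (f := fun i => dist (K i) L)
          (fun _ _ => dist_nonneg) (Finset.mem_univ i)).trans hn
      conv_lhs => rw [hun]
      rw [hmono.measure_iUnion]
      congr 1; funext n
      rw [← Measure.restrict_pi_pi, Measure.restrict_apply hA]
    rw [this]
    exact Measurable.iSup fun n => (Measure.measurable_coe hA).comp (key n)
  refine Measure.measurable_of_measurable_coe _ fun A hA => ?_
  simp only [factorialMeasure, Measure.restrict_apply hA]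
  exact (Measure.measurable_coe (hA.inter hinj)).comp hpi

end ParticleProcess

end

/-!
The proof is a coupling. Order the particles by their radius `|K|`, the distance of `K` to `{0}`,
and let the radius play the role of time. Since the intensity measure `ν = lam • μ` charges no
radius (`radiallyDiffuse_particleMeasure`: for each particle, the translations leading to a given
radius lie in the boundary of a convex set), a law satisfying the GNZ equation almost surely has
at most one particle of each radius, and particles arrive one after the other.

Let `k` be the predictable projection of the Papangelou intensity `κ`, its conditional expectation
given the particles of smaller radius (`exists_predictable_projection`). The GNZ equation says
that `k ν` is the compensator of `Ξ`. For a measurable function `f ≥ 0` of bounded support,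
integration by parts (`exp_add_sum_weight`) exhibits `exp (-∫ f dΞ + ∫ (1 - exp (-f)) k dν)`, up
to a given time, as a stochastic integral with respect to the compensated configuration, so that
its expectation is one (`IsGNZ.lintegral_exp_eq_one`). As `k ≤ 1`, it is possible to add to `Ξ`,
given `Ξ`, the points of a Poisson process with intensity measure `(1 - k) ν` (`completion`; the
points are sampled with uniform marks, and a point `K` is accepted if its mark is at most `1 -
k`). The exponential formula turns the Laplace functional of the resulting configuration into `exp
(-∫ (1 - exp (-f)) dν)`, which is that of the Poisson process. The Laplace functional determines
the law (`eq_of_lintegral_expFunctional_eq`), hence a configuration that is larger than `Ξ` is a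
Poisson process with intensity measure `ν`. This is `IsGNZ.stochDominated`.

For the Palm distributions, the GNZ equation of `Ξ`, applied to functions summed over all
`p`-tuples of different points, shows that for almost every `(K₁, …, K_p)` the reduced Palm
distribution satisfies the GNZ equation with the Papangelou intensity `κ (L, ζ + δ_{K₁} + … +
δ_{K_p})`, which is again at most one (`IsGNZ.ae_palm`). The exceptional null set can be chosen
independently of the test function because the σ-fields involved are countably generated and the
factorial moment measure is σ-finite (`Disintegrates.sigmaFinite`). Thus the first part applies to
the reduced Palm distributions as well.
-/

noncomputable section

namespace ParticleProcess

/-! ### Integration against a configuration that depends measurably on a parameter -/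

/-- A kernel that is finite on each set of a countable measurable cover is s-finite, even if the
bounds are not uniform in the parameter: cut the parameter space according to the mass of each
cell. -/
lemma isSFiniteKernel_of_cover {α β : Type*} [MeasurableSpace α] [MeasurableSpace β]
    (k : Kernel α β) (B : ℕ → Set β) (hB : ∀ n, MeasurableSet (B n)) (hun : ⋃ n, B n = Set.univ)
    (hfin : ∀ a n, k a (B n) < ∞) : IsSFiniteKernel k := by
  classical
  have hD : ∀ n, MeasurableSet (disjointed B n) := MeasurableSet.disjointed hB
  have hDfin : ∀ a n, k a (disjointed B n) < ∞ := fun a n =>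
    (measure_mono (disjointed_subset B n)).trans_lt (hfin a n)
  let S : ℕ → ℕ → Set α := fun n m => {a | ⌊(k a (disjointed B n)).toNNReal⌋₊ = m}
  have hS : ∀ n m, MeasurableSet (S n m) := fun n m => by
    have h : Measurable fun a => ⌊(k a (disjointed B n)).toNNReal⌋₊ :=
      ((k.measurable_coe (hD n)).ennreal_toNNReal).nat_floor
    exact h (measurableSet_singleton m)
  let K : ℕ → ℕ → Kernel α β := fun n m =>
    Kernel.piecewise (hS n m) (k.restrict (hD n)) 0
  have hK : ∀ n m, IsFiniteKernel (K n m) := fun n m => by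
    refine ⟨⟨(m + 1 : ℝ≥0∞), by simp, fun a => ?_⟩⟩
    by_cases ha : a ∈ S n m
    · simp only [K, Kernel.piecewise_apply, ha, if_true, Kernel.restrict_apply,
        Measure.restrict_apply_univ]
      have h := Nat.lt_floor_add_one (k a (disjointed B n)).toNNReal
      rw [show ⌊(k a (disjointed B n)).toNNReal⌋₊ = m from ha] at h
      rw [← ENNReal.coe_toNNReal (hDfin a n).ne]
      exact_mod_cast h.le
    · simp [K, Kernel.piecewise_apply, ha]
  have hsum : k = Kernel.sum fun n => Kernel.sum fun m => K n m := by
    ext a A hA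
    rw [Kernel.sum_apply' _ _ hA]
    have h1 : ∀ n, Kernel.sum (fun m => K n m) a A = k a (A ∩ disjointed B n) := fun n => by
      rw [Kernel.sum_apply' _ _ hA, tsum_eq_single ⌊(k a (disjointed B n)).toNNReal⌋₊]
      · have : a ∈ S n ⌊(k a (disjointed B n)).toNNReal⌋₊ := rfl
        simp [K, Kernel.piecewise_apply, this, Kernel.restrict_apply, hA]
      · intro m hm
        have : a ∉ S n m := fun h => hm (Eq.symm h)
        simp [K, Kernel.piecewise_apply, this]
    simp_rw [h1]
    rw [← measure_iUnion, ← Set.inter_iUnion, iUnion_disjointed, hun, Set.inter_univ]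
    · intro i j hij
      exact (disjoint_disjointed B hij).mono Set.inter_subset_right Set.inter_subset_right
    · exact fun n => hA.inter (hD n)
  rw [hsum]
  infer_instance

section Configurations

variable {d : ℕ}

lemma measurable_conf_apply {A : Set (Particle d)} (hA : MeasurableSet A) :
    Measurable fun ξ : Conf d => ξ.1 A :=
  (Measure.measurable_coe hA).comp measurable_subtype_coe

/-- A map into configurations is measurable as soon as all point counts are. -/
lemma measurable_conf_of_apply {α : Type*} [MeasurableSpace α] {g : α → Conf d}
    (h : ∀ A, MeasurableSet A → Measurable fun a => (g a).1 A) : Measurable g :=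
  Measurable.subtype_mk (f := fun a => (g a).1) (Measure.measurable_of_measurable_coe _ h)

/-- Configurations as a kernel from `Conf d` to the space of particles. -/
def confKernel (d : ℕ) : Kernel (Conf d) (Particle d) := ⟨fun ξ => ξ.1, measurable_subtype_coe⟩

instance : IsSFiniteKernel (confKernel d) := by
  obtain ⟨L⟩ : Nonempty (Particle d) := inferInstance
  exact isSFiniteKernel_of_cover _ (fun n : ℕ => Metric.closedBall L n)
    (fun n => Metric.isClosed_closedBall.measurableSet) (Metric.iUnion_closedBall_nat L)
    fun ξ n => ξ.2.2 L n

/-- Factorial measures as a kernel from `Conf d` to the space of tuples. -/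
def factorialKernel (d p : ℕ) : Kernel (Conf d) (Fin p → Particle d) :=
  ⟨factorialMeasure p, measurable_factorialMeasure p⟩

lemma factorialMeasure_closedBall_le {p : ℕ} (ξ : Conf d) (L : Particle d) (n : ℝ) :
    factorialMeasure p ξ (Set.univ.pi fun _ => Metric.closedBall L n) ≤
      ξ.1 (Metric.closedBall L n) ^ p := by
  have := isConf_sigmaFinite ξ
  refine (Measure.restrict_apply_le _ _).trans ?_
  rw [Measure.pi_pi]
  simp

lemma iUnion_pi_closedBall (p : ℕ) (L : Particle d) :
    ⋃ n : ℕ, (Set.univ.pi fun _ : Fin p => Metric.closedBall L (n : ℝ)) = Set.univ := by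
  refine Set.eq_univ_of_forall fun K => ?_
  obtain ⟨n, hn⟩ := exists_nat_ge (∑ i, dist (K i) L)
  refine Set.mem_iUnion.2 ⟨n, fun i _ => ?_⟩
  exact (Finset.single_le_sum (f := fun i => dist (K i) L)
    (fun _ _ => dist_nonneg) (Finset.mem_univ i)).trans hn

lemma measurableSet_pi_closedBall (p : ℕ) (L : Particle d) (n : ℝ) :
    MeasurableSet (Set.univ.pi fun _ : Fin p => Metric.closedBall L n) :=
  MeasurableSet.univ_pi fun _ => Metric.isClosed_closedBall.measurableSet

instance (p : ℕ) : IsSFiniteKernel (factorialKernel d p) := by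
  obtain ⟨L⟩ : Nonempty (Particle d) := inferInstance
  exact isSFiniteKernel_of_cover _ (fun n : ℕ => Set.univ.pi fun _ => Metric.closedBall L n)
    (fun n => measurableSet_pi_closedBall p L n) (iUnion_pi_closedBall p L) fun ξ n =>
      (factorialMeasure_closedBall_le ξ L n).trans_lt (ENNReal.pow_lt_top (ξ.2.2 L n))

lemma measurable_lintegral_conf {α : Type*} [MeasurableSpace α] {g : α → Conf d}
    (hg : Measurable g) {f : α → Particle d → ℝ≥0∞} (hf : Measurable (Function.uncurry f)) :
    Measurable fun a => ∫⁻ L, f a L ∂(g a).1 :=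
  Measurable.lintegral_kernel_prod_right' (κ := (confKernel d).comap g hg) hf

lemma measurable_lintegral_factorial {α : Type*} [MeasurableSpace α] {p : ℕ} {g : α → Conf d}
    (hg : Measurable g) {f : α → (Fin p → Particle d) → ℝ≥0∞}
    (hf : Measurable (Function.uncurry f)) :
    Measurable fun a => ∫⁻ K, f a K ∂(factorialMeasure p (g a)) :=
  Measurable.lintegral_kernel_prod_right' (κ := (factorialKernel d p).comap g hg) hf

/-! ### Operations on configurations -/

/-- The number of points of `ξ` in the section `{L | (a, L) ∈ S}` depends measurably on `a`. -/
lemma measurable_conf_section {α : Type*} [MeasurableSpace α] {g : α → Conf d}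
    (hg : Measurable g) {S : Set (α × Particle d)} (hS : MeasurableSet S) :
    Measurable fun a => (g a).1 {L | (a, L) ∈ S} := by
  have h := measurable_lintegral_conf hg (f := fun a L => S.indicator 1 (a, L))
    (measurable_one.indicator hS)
  convert h using 2 with a
  have : (fun L => S.indicator (1 : α × Particle d → ℝ≥0∞) (a, L)) =
      Set.indicator {L | (a, L) ∈ S} 1 := by
    ext L; by_cases hL : (a, L) ∈ S <;> simp [Set.indicator, hL]
  rw [this]
  exact (lintegral_indicator_one (measurable_prodMk_left hS)).symm

lemma measurable_erase_joint : Measurable fun q : Particle d × Conf d => erase q.2 q.1 := by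
  refine measurable_conf_of_apply fun A hA => ?_
  have h : (fun q : Particle d × Conf d => (erase q.2 q.1).1 A) = fun q =>
      if q.2.1 {L | (q, L) ∈ {r : (Particle d × Conf d) × Particle d | r.2 = r.1.1}} = 0
      then q.2.1 A else q.2.1 A - Measure.dirac q.1 A := by
    funext q
    have h1 : {L | (q, L) ∈ {r : (Particle d × Conf d) × Particle d | r.2 = r.1.1}} = {q.1} := by
      ext; simp
    rw [h1]
    split_ifs with h
    · simp only [erase, sub_dirac_of_eq_zero h]
    · exact Measure.sub_apply hA
        ((dirac_le_iff q.2.1 q.1).2 ((q.2.2.eq_zero_or_one_le q.1).resolve_left h))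
  have hA' : Measurable fun q : Particle d × Conf d => q.2.1 A :=
    (measurable_conf_apply hA).comp measurable_snd
  rw [h]
  refine Measurable.ite (measurable_conf_section measurable_snd ?_ (measurableSet_singleton 0))
    hA' (hA'.sub ?_)
  · exact measurableSet_eq_fun measurable_snd (measurable_fst.comp measurable_fst)
  · simp_rw [Measure.dirac_apply' _ hA]
    exact (measurable_one.indicator hA).comp measurable_fst

lemma measurable_erase_comp {α : Type*} [MeasurableSpace α] {g : α → Conf d} {h : α → Particle d}
    (hg : Measurable g) (hh : Measurable h) : Measurable fun a => erase (g a) (h a) := by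
  have := measurable_erase_joint.comp (hh.prodMk hg)
  simpa only [Function.comp_def] using this

lemma measurable_eraseAll_joint {p : ℕ} :
    Measurable fun q : (Fin p → Particle d) × Conf d => eraseAll q.2 q.1 := by
  suffices h : ∀ l : List (Fin p), Measurable fun q : (Fin p → Particle d) × Conf d =>
      (l.map q.1).foldl erase q.2 by
    simpa [eraseAll, List.ofFn_eq_map] using h (List.finRange p)
  suffices h : ∀ l : List (Fin p), ∀ g : (Fin p → Particle d) × Conf d → Conf d, Measurable g →
      Measurable fun q => (l.map q.1).foldl erase (g q) from fun l => h l _ measurable_snd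
  intro l
  induction l with
  | nil => exact fun g hg => hg
  | cons a l ih =>
    intro g hg
    have h : Measurable fun q : (Fin p → Particle d) × Conf d => erase (g q) (q.1 a) :=
      measurable_erase_comp hg ((measurable_pi_apply a).comp measurable_fst)
    simp only [List.map_cons, List.foldl_cons]
    exact ih _ h

lemma measurable_eraseAll_comp {α : Type*} [MeasurableSpace α] {p : ℕ} {g : α → Conf d}
    {h : α → Fin p → Particle d} (hg : Measurable g) (hh : Measurable h) :
    Measurable fun a => eraseAll (g a) (h a) := by
  have := measurable_eraseAll_joint.comp (hh.prodMk hg)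
  simpa only [Function.comp_def] using this

lemma IsConf.restrict {ξ : Measure (Particle d)} (hξ : IsConf ξ) {S : Set (Particle d)}
    (hS : MeasurableSet S) : IsConf (ξ.restrict S) :=
  ⟨fun A hA => by rw [Measure.restrict_apply hA]; exact hξ.1 _ (hA.inter hS),
    fun K r => (Measure.restrict_apply_le _ _).trans_lt (hξ.2 K r)⟩

/-- The set of numbers `0, 1, 2, …, ∞` is closed under countable sums. -/
lemma exists_enat_tsum {f : ℕ → ℝ≥0∞} (h : ∀ i, ∃ n : ℕ∞, f i = (n : ℝ≥0∞)) :
    ∃ n : ℕ∞, ∑' i, f i = (n : ℝ≥0∞) := by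
  choose n hn using h
  refine ⟨⨆ s : ℕ, ∑ i ∈ Finset.range s, n i, ?_⟩
  rw [ENat.toENNReal_iSup, ENNReal.tsum_eq_iSup_nat]
  refine iSup_congr fun s => ?_
  simp only [hn]
  exact (map_sum ENat.toENNRealRingHom _ _).symm

lemma IsConf.add {ξ η : Measure (Particle d)} (hξ : IsConf ξ) (hη : IsConf η) :
    IsConf (ξ + η) := by
  refine ⟨fun A hA => ?_, fun K r => ?_⟩
  · obtain ⟨m, hm⟩ := hξ.1 A hA
    obtain ⟨n, hn⟩ := hη.1 A hA
    exact ⟨m + n, by simp [hm, hn]⟩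
  · simpa using ⟨hξ.2 K r, hη.2 K r⟩

lemma isConf_dirac (K : Particle d) : IsConf (Measure.dirac K) := by
  refine ⟨fun A hA => ?_, fun L r => measure_lt_top _ _⟩
  by_cases hK : K ∈ A
  · exact ⟨1, by simp [hK]⟩
  · exact ⟨0, by simp [Measure.dirac_apply' K hA, hK]⟩

lemma isConf_sum_dirac {ι : Type*} (s : Finset ι) (K : ι → Particle d) :
    IsConf (∑ i ∈ s, Measure.dirac (K i)) := by
  classical
  induction s using Finset.induction_on with
  | empty => exact ⟨fun A _ => ⟨0, by simp⟩, fun _ _ => by simp⟩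
  | insert a s ha ih => rw [Finset.sum_insert ha]; exact (isConf_dirac _).add ih

/-- A configuration with finitely many points is a finite sum of point masses. -/
lemma exists_eq_sum_dirac (n : ℕ) : ∀ {ξ : Measure (Particle d)}, IsConf ξ → ξ Set.univ = n →
    ∃ K : Fin n → Particle d, ξ = ∑ i, Measure.dirac (K i) := by
  induction n with
  | zero =>
    intro ξ _ h0
    exact ⟨Fin.elim0, by simpa using h0⟩
  | succ n ih =>
    intro ξ hξ hn
    have hne : ξ Set.univ ≠ 0 := by rw [hn]; exact_mod_cast n.succ_ne_zero
    have : IsFiniteMeasure ξ := ⟨by rw [hn]; exact ENNReal.natCast_lt_top _⟩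
    obtain ⟨K, -, hK⟩ := exists_mem_forall_mem_nhdsWithin_pos_measure hne
    have h1 : ∀ k : ℕ, 1 ≤ ξ (Metric.closedBall K (1 / ((k : ℝ) + 1))) := fun k => by
      obtain ⟨m, hm⟩ := hξ.1 (Metric.closedBall K (1 / ((k : ℝ) + 1)))
        Metric.isClosed_closedBall.measurableSet
      have hpos := hK (Metric.closedBall K (1 / ((k : ℝ) + 1)))
        (by rw [nhdsWithin_univ]; exact Metric.closedBall_mem_nhds K (by positivity))
      rw [hm] at hpos ⊢
      have : m ≠ 0 := by rintro rfl; simp at hpos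
      exact_mod_cast Order.one_le_iff_pos.2 (pos_iff_ne_zero.2 this)
    have h2 : ⋂ k : ℕ, Metric.closedBall K (1 / ((k : ℝ) + 1)) = {K} := by
      ext L
      simp only [Set.mem_iInter, Metric.mem_closedBall, Set.mem_singleton_iff]
      refine ⟨fun h => ?_, fun h k => by subst h; rw [dist_self]; positivity⟩
      exact dist_le_zero.1 (ge_of_tendsto' tendsto_one_div_add_atTop_nhds_zero_nat h)
    have h3 : 1 ≤ ξ {K} := by
      have hanti : Antitone fun k : ℕ => Metric.closedBall K (1 / ((k : ℝ) + 1)) :=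
        fun a b hab => Metric.closedBall_subset_closedBall
          (one_div_le_one_div_of_le (by positivity) (by gcongr))
      rw [← h2, hanti.measure_iInter
        (fun k => Metric.isClosed_closedBall.measurableSet.nullMeasurableSet)
        ⟨0, (measure_lt_top _ _).ne⟩]
      exact le_iInf h1
    have hle := (dirac_le_iff ξ K).2 h3
    obtain ⟨L, hL⟩ := ih (hξ.sub_dirac K) (by
      rw [Measure.sub_apply MeasurableSet.univ hle, hn]; simp)
    refine ⟨Fin.cons K L, ?_⟩
    rw [Fin.sum_univ_succ]
    simp only [Fin.cons_zero, Fin.cons_succ, ← hL]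
    rw [add_comm, Measure.sub_add_cancel_of_le hle]

end Configurations

/-! ### Ordering the particles by radius -/

section Radius

variable {d : ℕ}

/-- The Hausdorff distance of a particle to `{0}`, that is, the radius of the smallest centred ball
containing it. It plays the role of time: it is the order in which particles are revealed. -/
def radius (K : Particle d) : ℝ := dist K ({0} : Particle d)

@[fun_prop]
lemma measurable_radius : Measurable (radius : Particle d → ℝ) :=
  (continuous_id.dist continuous_const).measurable

lemma radius_nonneg (K : Particle d) : 0 ≤ radius K := dist_nonneg

lemma conf_radius_lt_top (ξ : Conf d) (t : ℝ) : ξ.1 {K | radius K ≤ t} < ∞ := ξ.2.2 {0} t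

lemma measurableSet_radius_le (t : ℝ) : MeasurableSet {K : Particle d | radius K ≤ t} :=
  measurableSet_le measurable_radius measurable_const

lemma measurableSet_radius_lt (t : ℝ) : MeasurableSet {K : Particle d | radius K < t} :=
  measurableSet_lt measurable_radius measurable_const

lemma measurableSet_radius_eq (t : ℝ) : MeasurableSet {K : Particle d | radius K = t} :=
  measurableSet_eq_fun measurable_radius measurable_const

/-- The points of `ξ` of radius less than `t`. -/
def past (t : ℝ) (ξ : Conf d) : Conf d :=
  ⟨ξ.1.restrict {L | radius L < t}, ξ.2.restrict (measurableSet_radius_lt t)⟩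

lemma measurable_past : Measurable fun q : ℝ × Conf d => past q.1 q.2 := by
  refine measurable_conf_of_apply fun A hA => ?_
  have h : MeasurableSet {r : (ℝ × Conf d) × Particle d | r.2 ∈ A ∧ radius r.2 < r.1.1} :=
    (measurable_snd hA).inter
      (measurableSet_lt (measurable_radius.comp measurable_snd)
        (measurable_fst.comp measurable_fst))
  convert measurable_conf_section measurable_snd h using 2 with q
  simp only [past, Measure.restrict_apply hA]
  rfl

lemma past_past {s t : ℝ} (h : s ≤ t) (ξ : Conf d) : past s (past t ξ) = past s ξ := by
  refine Subtype.ext ?_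
  simp only [past, Measure.restrict_restrict (measurableSet_radius_lt s)]
  congr 1
  ext L
  exact ⟨fun hL => hL.1, fun hL => ⟨hL, lt_of_lt_of_le hL h⟩⟩

lemma erase_apply_of_notMem (ξ : Conf d) {K : Particle d} {A : Set (Particle d)}
    (hA : MeasurableSet A) (hK : K ∉ A) : (erase ξ K).1 A = ξ.1 A := by
  rcases ξ.2.eq_zero_or_one_le K with h | h
  · simp [erase, sub_dirac_of_eq_zero h]
  · simp [erase, Measure.sub_apply hA ((dirac_le_iff ξ.1 K).2 h), Measure.dirac_apply' K hA, hK]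

lemma le_erase_add_one (ξ : Conf d) (K : Particle d) {A : Set (Particle d)}
    (hA : MeasurableSet A) : ξ.1 A ≤ (erase ξ K).1 A + 1 := by
  rcases ξ.2.eq_zero_or_one_le K with h | h
  · simp [erase, sub_dirac_of_eq_zero h]
  · simp only [erase, Measure.sub_apply hA ((dirac_le_iff ξ.1 K).2 h)]
    refine (le_tsub_add (a := Measure.dirac K A)).trans ?_
    gcongr
    exact prob_le_one

/-- Removing a point does not change its own past. -/
lemma past_erase (ξ : Conf d) (K : Particle d) :
    past (radius K) (erase ξ K) = past (radius K) ξ := by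
  refine Subtype.ext (Measure.ext fun A hA => ?_)
  simp only [past, Measure.restrict_apply hA]
  exact erase_apply_of_notMem ξ (hA.inter (measurableSet_radius_lt _)) (by simp)

end Radius

/-! ### An exponential formula for finite point sets -/

/-- The primitive of `exp ∘ F`, for the distribution function `F` of an atomless measure. -/
lemma lintegral_exp_measure_Iio (b : Measure ℝ) [IsFiniteMeasure b] [NullSingletonClass b] :
    ∫⁻ t, ENNReal.ofReal (Real.exp (b.real (Set.Iio t))) ∂b + 1 =
      ENNReal.ofReal (Real.exp (b.real Set.univ)) := by
  set B : ℝ := b.real Set.univ with hB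
  have hB0 : 0 ≤ B := measureReal_nonneg
  let F : ℝ → ℝ := fun t => b.real (Set.Iio t)
  have hFmono : Monotone F := fun s t h => measureReal_mono (Set.Iio_subset_Iio h)
  have hFm : Measurable F := hFmono.measurable
  have hF0 : ∀ t, 0 ≤ F t := fun t => measureReal_nonneg
  have hFB : ∀ t, F t ≤ B := fun t => measureReal_mono (Set.subset_univ _)
  have hIic : ∀ t, b.real (Set.Iic t) = F t := fun t =>
    (measureReal_congr Iio_ae_eq_Iic).symm
  have hbot : Filter.Tendsto F Filter.atBot (nhds 0) := by
    have h := tendsto_measure_Ici_atBot b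
    have h2 := (ENNReal.tendsto_toReal (measure_ne_top b _)).comp h
    have h3 : F = fun t => B - b.real (Set.Ici t) := by
      funext t
      rw [eq_sub_iff_add_eq, ← measureReal_union (Set.Iio_disjoint_Ici le_rfl) measurableSet_Ici,
        Set.Iio_union_Ici]
    rw [h3]
    simpa [hB, Measure.real] using h2.const_sub B
  have htop : Filter.Tendsto F Filter.atTop (nhds B) := by
    have h := tendsto_measure_Iic_atTop b
    have h2 := (ENNReal.tendsto_toReal (measure_ne_top b _)).comp h
    exact h2.congr hIic
  have hcont : Continuous F := by
    have hF : F = fun t => ∫ x, (Set.Iio t).indicator (fun _ => (1 : ℝ)) x ∂b := by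
      funext t
      rw [integral_indicator_const _ measurableSet_Iio, smul_eq_mul, mul_one]
    rw [hF, continuous_iff_continuousAt]
    intro t
    refine continuousAt_of_dominated (bound := fun _ => 1)
      (Filter.Eventually.of_forall fun s =>
        (measurable_const.indicator measurableSet_Iio).aestronglyMeasurable)
      (Filter.Eventually.of_forall fun s => Filter.Eventually.of_forall fun x => ?_)
      (integrable_const _) ?_
    · by_cases hx : x ∈ Set.Iio s <;> simp [hx]
    · have ht : ∀ᵐ x ∂b, x ≠ t := by
        rw [ae_iff]; simp
      filter_upwards [ht] with x hx
      rcases lt_or_gt_of_ne hx with h | h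
      · refine (continuousAt_const (y := (1 : ℝ))).congr ?_
        filter_upwards [lt_mem_nhds h] with s hs
        simp [hs]
      · refine (continuousAt_const (y := (0 : ℝ))).congr ?_
        filter_upwards [gt_mem_nhds h] with s hs
        simp [hs.le]
  have hIVT : ∀ y, 0 < y → y < B → ∃ t, F t = y := fun y h0 h1 => by
    obtain ⟨s, hs⟩ := (hbot.eventually (gt_mem_nhds h0)).exists
    obtain ⟨t, ht⟩ := (htop.eventually (lt_mem_nhds h1)).exists
    exact mem_range_of_exists_le_of_exists_ge hcont ⟨s, hs.le⟩ ⟨t, ht.le⟩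
  -- the image of `b` under its distribution function is uniform
  have hmap : b.map F = volume.restrict (Set.Icc 0 B) := by
    have : IsFiniteMeasure (b.map F) := by infer_instance
    refine Measure.ext_of_Iic _ _ fun x => ?_
    rw [Measure.map_apply hFm measurableSet_Iic, Measure.restrict_apply measurableSet_Iic]
    rcases lt_or_ge x 0 with hx | hx
    · have h1 : F ⁻¹' Set.Iic x = ∅ := by
        ext t; simp only [Set.mem_preimage, Set.mem_Iic, Set.mem_empty_iff_false, iff_false, not_le]
        exact hx.trans_le (hF0 t)
      have h2 : Set.Iic x ∩ Set.Icc 0 B = ∅ := by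
        ext t; simp only [Set.mem_inter_iff, Set.mem_Iic, Set.mem_Icc, Set.mem_empty_iff_false,
          iff_false]
        rintro ⟨h, h', -⟩; linarith
      rw [h1, h2]; simp
    rcases le_or_gt B x with hxB | hxB
    · have h1 : F ⁻¹' Set.Iic x = Set.univ := Set.eq_univ_of_forall fun t => (hFB t).trans hxB
      have h2 : Set.Iic x ∩ Set.Icc 0 B = Set.Icc 0 B :=
        Set.inter_eq_right.2 fun t ht => ht.2.trans hxB
      rw [h1, h2, Real.volume_Icc, sub_zero, hB, ofReal_measureReal]
    have h2 : Set.Iic x ∩ Set.Icc 0 B = Set.Icc 0 x := by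
      ext t; simp only [Set.mem_inter_iff, Set.mem_Iic, Set.mem_Icc]
      exact ⟨fun h => ⟨h.2.1, h.1⟩, fun h => ⟨h.2, h.1, h.2.trans hxB.le⟩⟩
    rw [h2, Real.volume_Icc, sub_zero]
    have hF' : ∀ t, b (Set.Iic t) = ENNReal.ofReal (F t) := fun t => by
      rw [← hIic, ofReal_measureReal]
    refine le_antisymm ?_ ?_
    · refine le_of_forall_gt_imp_ge_of_dense fun z hz => ?_
      rcases le_or_gt (ENNReal.ofReal B) z with hzB | hzB
      · refine (measure_mono (Set.subset_univ _)).trans (le_trans ?_ hzB)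
        rw [hB, ofReal_measureReal]
      have hz' : z ≠ ∞ := hzB.ne_top
      have hxz : x < z.toReal := (ENNReal.ofReal_lt_iff_lt_toReal hx hz').1 hz
      obtain ⟨t, ht⟩ := hIVT z.toReal (hx.trans_lt hxz)
        ((ENNReal.lt_ofReal_iff_toReal_lt hz').1 hzB)
      calc b (F ⁻¹' Set.Iic x) ≤ b (Set.Iic t) := measure_mono fun s hs => by
            by_contra hst
            have h3 := hFmono (not_le.1 hst).le
            have h4 : F s ≤ x := hs
            linarith
        _ = z := by rw [hF', ht, ENNReal.ofReal_toReal hz']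
    · rcases hx.eq_or_lt with h0 | h0
      · simp [← h0]
      obtain ⟨t, ht⟩ := hIVT x h0 hxB
      rw [← ht, ← hF']
      exact measure_mono fun s hs => hFmono hs
  have h1 : ∫⁻ t, ENNReal.ofReal (Real.exp (b.real (Set.Iio t))) ∂b =
      ∫⁻ x in Set.Icc 0 B, ENNReal.ofReal (Real.exp x) := by
    rw [← hmap, lintegral_map (by fun_prop) hFm]
  rw [h1, ← ofReal_integral_eq_lintegral_ofReal
    (Real.continuous_exp.integrableOn_Icc)
    (Filter.Eventually.of_forall fun x => (Real.exp_pos x).le),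
    integral_Icc_eq_integral_Ioc, ← intervalIntegral.integral_of_le hB0, integral_exp,
    ← ENNReal.ofReal_one, ← ENNReal.ofReal_add (by simpa using hB0) (by norm_num)]
  simp

/-- The previous formula, after a given time. -/
lemma setLIntegral_exp_measure_Iio (b : Measure ℝ) [IsFiniteMeasure b] [NullSingletonClass b]
    (s : ℝ) :
    ∫⁻ t in Set.Ioi s, ENNReal.ofReal (Real.exp (b.real (Set.Iio t))) ∂b +
        ENNReal.ofReal (Real.exp (b.real (Set.Iio s))) =
      ENNReal.ofReal (Real.exp (b.real Set.univ)) := by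
  have h := lintegral_exp_measure_Iio (b.restrict (Set.Ioi s))
  have hIio : b.real (Set.Iio s) = b.real (Set.Iic s) := measureReal_congr Iio_ae_eq_Iic
  have h1 : ∀ t ∈ Set.Ioi s, b.real (Set.Iio t) =
      b.real (Set.Iio s) + (b.restrict (Set.Ioi s)).real (Set.Iio t) := fun t ht => by
    rw [measureReal_restrict_apply measurableSet_Iio, hIio,
      ← measureReal_union _ (measurableSet_Iio.inter measurableSet_Ioi)]
    · congr 1
      ext x
      simp only [Set.mem_Iio, Set.mem_union, Set.mem_Iic, Set.mem_inter_iff, Set.mem_Ioi]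
      have : s < t := ht
      constructor
      · intro hx; rcases le_or_gt x s with h | h
        · exact Or.inl h
        · exact Or.inr ⟨hx, h⟩
      · rintro (h | h)
        · exact h.trans_lt this
        · exact h.1
    · exact Set.disjoint_left.2 fun x hx hx' =>
        not_lt.2 (Set.mem_Iic.1 hx) (Set.mem_Ioi.1 hx'.2)
  have h2 : b.real Set.univ = b.real (Set.Iio s) + (b.restrict (Set.Ioi s)).real Set.univ := by
    rw [measureReal_restrict_apply MeasurableSet.univ, hIio, Set.univ_inter,
      ← measureReal_union (Set.Iic_disjoint_Ioi le_rfl) measurableSet_Ioi, Set.Iic_union_Ioi]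
  rw [setLIntegral_congr_fun measurableSet_Ioi (g := fun t =>
    ENNReal.ofReal (Real.exp (b.real (Set.Iio s))) *
      ENNReal.ofReal (Real.exp ((b.restrict (Set.Ioi s)).real (Set.Iio t)))),
    lintegral_const_mul', h2,
    Real.exp_add, ENNReal.ofReal_mul (Real.exp_pos _).le, ← h, mul_add, mul_one]
  · exact ENNReal.ofReal_ne_top
  · intro t ht
    simp only
    rw [h1 t ht, Real.exp_add, ENNReal.ofReal_mul (Real.exp_pos _).le]

section Finite

variable {d : ℕ}

/-- The weight attached to a particle `K` by the points of `s` and the part of `β` that come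
before it. -/
def weight (f : Particle d → ℝ≥0) (β : Measure (Particle d)) (s : Finset (Particle d))
    (K : Particle d) : ℝ≥0∞ :=
  ENNReal.ofReal (Real.exp (-(∑ L ∈ s with radius L < radius K, (f L : ℝ)) +
    β.real {L | radius L < radius K}))

/-- Integration by parts, for a pure-jump factor times a continuous factor. -/
lemma exp_add_sum_weight (f : Particle d → ℝ≥0) (β : Measure (Particle d)) [IsFiniteMeasure β]
    (hβ : ∀ t, β {K | radius K = t} = 0) (s : Finset (Particle d))
    (hs : Set.InjOn radius (s : Set (Particle d))) :
    ENNReal.ofReal (Real.exp (-(∑ L ∈ s, (f L : ℝ)) + β.real Set.univ)) +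
        ∑ K ∈ s, weight f β s K * ENNReal.ofReal (1 - Real.exp (-(f K : ℝ))) =
      1 + ∫⁻ K, weight f β s K ∂β := by
  classical
  let b : Measure ℝ := β.map radius
  have hbm : ∀ {S : Set ℝ}, MeasurableSet S → b.real S = β.real (radius ⁻¹' S) := fun hS => by
    simp only [b, Measure.real, Measure.map_apply measurable_radius hS]
  have : NullSingletonClass b := ⟨fun t => by
    rw [Measure.map_apply measurable_radius (measurableSet_singleton t)]; exact hβ t⟩
  have hF : ∀ t, b.real (Set.Iio t) = β.real {L | radius L < t} := fun t =>
    hbm measurableSet_Iio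
  have hFm : Measurable fun t => b.real (Set.Iio t) := by
    have : Monotone fun t => b.real (Set.Iio t) :=
      fun s t h => measureReal_mono (Set.Iio_subset_Iio h)
    exact this.measurable
  have hU : b.real Set.univ = β.real Set.univ := hbm MeasurableSet.univ
  have hbase := lintegral_exp_measure_Iio b
  rw [lintegral_map (by fun_prop) measurable_radius, hU] at hbase
  simp only [hF] at hbase
  have htail : ∀ t, ∫⁻ K in {K | t < radius K}, ENNReal.ofReal
      (Real.exp (β.real {L | radius L < radius K})) ∂β +
        ENNReal.ofReal (Real.exp (β.real {L | radius L < t})) =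
      ENNReal.ofReal (Real.exp (β.real Set.univ)) := fun t => by
    have h := setLIntegral_exp_measure_Iio b t
    rw [setLIntegral_map measurableSet_Ioi (by fun_prop) measurable_radius, hU] at h
    simp only [hF] at h
    exact h
  revert hs
  refine Finset.induction_on_max_value radius s ?_ fun a s ha hmax ih hs => ?_
  · intro _
    simp [weight, ← hbase, add_comm]
  have hlt : ∀ K ∈ s, radius K < radius a := fun K hK => lt_of_le_of_ne (hmax K hK) fun h =>
    ha (hs (by simp [hK]) (by simp) h ▸ hK)
  have hih := ih (hs.mono (by simp))
  have hw1 : ∀ K, radius K ≤ radius a → weight f β (insert a s) K = weight f β s K :=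
    fun K hK => by
      rw [weight, Finset.filter_insert, if_neg (not_lt.2 hK), weight]
  have hw2 : ∀ K, radius a < radius K → weight f β s K =
      ENNReal.ofReal (Real.exp (-(∑ L ∈ s, (f L : ℝ)))) *
        ENNReal.ofReal (Real.exp (β.real {L | radius L < radius K})) := fun K hK => by
    rw [weight, Finset.filter_true_of_mem fun L hL => (hlt L hL).trans hK, Real.exp_add,
      ENNReal.ofReal_mul (Real.exp_pos _).le]
  have hw3 : ∀ K, radius a < radius K → weight f β (insert a s) K =
      ENNReal.ofReal (Real.exp (-(f a : ℝ))) * weight f β s K := fun K hK => by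
    rw [weight, weight, Finset.filter_insert, if_pos hK, Finset.sum_insert (by simp [ha]),
      ← ENNReal.ofReal_mul (Real.exp_pos _).le, ← Real.exp_add]
    congr 2; ring
  have hwa : weight f β s a = ENNReal.ofReal (Real.exp (-(∑ L ∈ s, (f L : ℝ)))) *
        ENNReal.ofReal (Real.exp (β.real {L | radius L < radius a})) := by
    rw [weight, Finset.filter_true_of_mem fun L hL => hlt L hL, Real.exp_add,
      ENNReal.ofReal_mul (Real.exp_pos _).le]
  have hmeas : MeasurableSet {K : Particle d | radius K ≤ radius a} := measurableSet_radius_le _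
  have hmeas' : MeasurableSet {K : Particle d | radius a < radius K} :=
    measurableSet_lt measurable_const measurable_radius
  have hcompl : {K : Particle d | radius K ≤ radius a}ᶜ = {K | radius a < radius K} := by
    ext; simp
  have hsplit : ∀ w : Particle d → ℝ≥0∞, ∫⁻ K, w K ∂β =
      ∫⁻ K in {K | radius K ≤ radius a}, w K ∂β + ∫⁻ K in {K | radius a < radius K}, w K ∂β :=
    fun w => by rw [← hcompl, lintegral_add_compl _ hmeas]
  set I := ∫⁻ K in {K | radius a < radius K}, weight f β s K ∂β with hI
  set A := ∫⁻ K in {K | radius K ≤ radius a}, weight f β s K ∂β with hA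
  have hI' : I + weight f β s a =
      ENNReal.ofReal (Real.exp (-(∑ L ∈ s, (f L : ℝ)) + β.real Set.univ)) := by
    rw [hI, setLIntegral_congr_fun hmeas' fun K hK => hw2 K hK,
      lintegral_const_mul' _ _ ENNReal.ofReal_ne_top, hwa, ← mul_add, htail, Real.exp_add,
      ENNReal.ofReal_mul (Real.exp_pos _).le]
  have hIfin : I ≠ ∞ := fun h => by
    rw [h, top_add] at hI'; exact ENNReal.ofReal_ne_top hI'.symm
  have hA' : ∫⁻ K in {K | radius K ≤ radius a}, weight f β (insert a s) K ∂β = A :=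
    setLIntegral_congr_fun hmeas fun K hK => hw1 K hK
  have hI2 : ∫⁻ K in {K | radius a < radius K}, weight f β (insert a s) K ∂β =
      ENNReal.ofReal (Real.exp (-(f a : ℝ))) * I := by
    rw [setLIntegral_congr_fun hmeas' fun K hK => hw3 K hK,
      lintegral_const_mul' _ _ ENNReal.ofReal_ne_top]
  rw [hsplit, ← hI', ← hA, ← hI] at hih
  have hsum : ∑ K ∈ s, weight f β (insert a s) K * ENNReal.ofReal (1 - Real.exp (-(f K : ℝ))) =
      ∑ K ∈ s, weight f β s K * ENNReal.ofReal (1 - Real.exp (-(f K : ℝ))) :=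
    Finset.sum_congr rfl fun K hK => by rw [hw1 K (hlt K hK).le]
  rw [hsplit, hA', hI2, Finset.sum_insert ha, Finset.sum_insert ha, hw1 a le_rfl,
    hsum]
  set S := ∑ K ∈ s, weight f β s K * ENNReal.ofReal (1 - Real.exp (-(f K : ℝ)))
  set D := weight f β s a
  have hu : ENNReal.ofReal (Real.exp (-(f a : ℝ))) + ENNReal.ofReal (1 - Real.exp (-(f a : ℝ))) =
      1 := by
    rw [← ENNReal.ofReal_add (Real.exp_pos _).le (by simp)]
    simp
  have hZ : ENNReal.ofReal (Real.exp (-((f a : ℝ) + ∑ L ∈ s, (f L : ℝ)) + β.real Set.univ)) =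
      ENNReal.ofReal (Real.exp (-(f a : ℝ))) * (I + D) := by
    rw [hI', ← ENNReal.ofReal_mul (Real.exp_pos _).le, ← Real.exp_add]
    congr 2; ring
  set u := ENNReal.ofReal (Real.exp (-(f a : ℝ)))
  set g := ENNReal.ofReal (1 - Real.exp (-(f a : ℝ)))
  have hDS : D + S = 1 + A := by
    refine (ENNReal.add_right_inj hIfin).1 ?_
    rw [← add_assoc, hih]; ring
  rw [hZ]
  calc u * (I + D) + (D * g + S) = u * I + ((u + g) * D + S) := by ring
    _ = 1 + (A + u * I) := by rw [hu, one_mul, hDS]; ring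

end Finite

/-! ### Consequences of the GNZ equation -/

section GNZ

variable {d : ℕ}

/-- The GNZ equation for a law `P` on configurations. The activity is part of `ν`. -/
def IsGNZ (P : Measure (Conf d)) (κ : Particle d × Conf d → ℝ≥0∞) (ν : Measure (Particle d)) :
    Prop :=
  ∀ f : Particle d × Conf d → ℝ≥0∞, Measurable f →
    ∫⁻ ξ, ∫⁻ K, f (K, erase ξ K) ∂ξ.1 ∂P = ∫⁻ ξ, ∫⁻ K, f (K, ξ) * κ (K, ξ) ∂ν ∂P

/-- The measure `ν` is locally finite, and no radius has positive mass. -/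
structure RadiallyDiffuse (ν : Measure (Particle d)) : Prop where
  finite : ∀ t, ν {K | radius K ≤ t} < ∞
  null : ∀ t, ν {K | radius K = t} = 0

lemma iUnion_radius_le : ⋃ n : ℕ, {K : Particle d | radius K ≤ n} = Set.univ :=
  Set.eq_univ_of_forall fun K => Set.mem_iUnion.2 (exists_nat_ge (radius K))

lemma RadiallyDiffuse.sigmaFinite {ν : Measure (Particle d)} (h : RadiallyDiffuse ν) :
    SigmaFinite ν :=
  ⟨⟨⟨fun n : ℕ => {K | radius K ≤ n}, fun _ => trivial, fun n => h.finite n, iUnion_radius_le⟩⟩⟩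

/-- Almost surely, different points of the configuration have different radii, and no point is
multiple. -/
lemma IsGNZ.ae_radius_le_one {P : Measure (Conf d)} {κ : Particle d × Conf d → ℝ≥0∞}
    {ν : Measure (Particle d)} (hP : IsGNZ P κ ν) (hκ : ∀ q, κ q ≤ 1) (hν : RadiallyDiffuse ν) :
    ∀ᵐ ξ ∂P, ∀ t, ξ.1 {K | radius K = t} ≤ 1 := by
  have := hν.sigmaFinite
  have hS : MeasurableSet {r : (Particle d × Conf d) × Particle d | radius r.2 = radius r.1.1} :=
    measurableSet_eq_fun (measurable_radius.comp measurable_snd)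
      (measurable_radius.comp (measurable_fst.comp measurable_fst))
  have hf : Measurable fun q : Particle d × Conf d => q.2.1 {L | radius L = radius q.1} :=
    measurable_conf_section measurable_snd hS
  have h1 : ∀ ξ : Conf d, ∫⁻ K, ξ.1 {L | radius L = radius K} * κ (K, ξ) ∂ν = 0 := fun ξ => by
    have := isConf_sigmaFinite ξ
    have hT : MeasurableSet {r : Particle d × Particle d | radius r.2 = radius r.1} :=
      measurableSet_eq_fun (measurable_radius.comp measurable_snd)
        (measurable_radius.comp measurable_fst)
    refine le_antisymm ?_ zero_le
    calc ∫⁻ K, ξ.1 {L | radius L = radius K} * κ (K, ξ) ∂ν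
        ≤ ∫⁻ K, ξ.1 {L | radius L = radius K} ∂ν :=
          lintegral_mono fun K => (mul_le_mul_right (hκ _) _).trans (mul_one _).le
      _ = (ν.prod ξ.1) {r | radius r.2 = radius r.1} := (Measure.prod_apply hT).symm
      _ = ∫⁻ L, ν {K | radius L = radius K} ∂ξ.1 := Measure.prod_apply_symm hT
      _ = 0 := by simp [fun t => show ν {K | t = radius K} = 0 by simpa [eq_comm] using hν.null t]
  have h0 := hP _ hf
  simp only [h1, lintegral_zero] at h0
  have hm : Measurable fun ξ : Conf d => ∫⁻ K, (erase ξ K).1 {L | radius L = radius K} ∂ξ.1 := by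
    refine measurable_lintegral_conf measurable_id (f := fun ξ K =>
      (erase ξ K).1 {L | radius L = radius K}) ?_
    exact hf.comp (measurable_snd.prodMk (measurable_erase_joint.comp measurable_swap))
  filter_upwards [(lintegral_eq_zero_iff hm).1 h0] with ξ hξ t
  by_contra hlt
  rw [not_le] at hlt
  have h2 : ∀ K ∈ {K : Particle d | radius K = t}, 1 ≤ (erase ξ K).1 {L | radius L = radius K} := by
    rintro K rfl
    have h3 := le_erase_add_one ξ K (measurableSet_radius_eq (radius K))
    obtain ⟨n, hn⟩ := (erase ξ K).2.1 _ (measurableSet_radius_eq (radius K))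
    rw [hn] at h3 ⊢
    have : n ≠ 0 := by
      rintro rfl
      simp at h3
      exact absurd h3 (not_le.2 hlt)
    exact_mod_cast Order.one_le_iff_pos.2 (pos_iff_ne_zero.2 this)
  have h4 : ξ.1 {K | radius K = t} ≤ ∫⁻ K, (erase ξ K).1 {L | radius L = radius K} ∂ξ.1 :=
    calc ξ.1 {K | radius K = t} = ∫⁻ K in {K | radius K = t}, 1 ∂ξ.1 := by simp
      _ ≤ ∫⁻ K in {K | radius K = t}, (erase ξ K).1 {L | radius L = radius K} ∂ξ.1 :=
          setLIntegral_mono' (measurableSet_radius_eq t) h2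
      _ ≤ _ := setLIntegral_le_lintegral _ _
  rw [show ∫⁻ K, (erase ξ K).1 {L | radius L = radius K} ∂ξ.1 = 0 from hξ] at h4
  exact absurd (hlt.trans_le h4) (by simp)

/-- Within a ball, a configuration without ties is a finite set of points. -/
lemma exists_finset_of_radius_le_one {ξ : Conf d} (hξ : ∀ t, ξ.1 {K | radius K = t} ≤ 1) (T : ℝ) :
    ∃ s : Finset (Particle d), Set.InjOn radius (s : Set (Particle d)) ∧
      ξ.1.restrict {K | radius K ≤ T} = ∑ K ∈ s, Measure.dirac K := by
  classical
  obtain ⟨n, hn⟩ := ξ.2.1 _ (measurableSet_radius_le T)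
  have hfin := conf_radius_lt_top ξ T
  rw [hn] at hfin
  have hn' : n ≠ ⊤ := by rintro rfl; simp at hfin
  lift n to ℕ using hn'
  obtain ⟨K, hK⟩ := exists_eq_sum_dirac n (ξ.2.restrict (measurableSet_radius_le T))
    (by rw [Measure.restrict_apply_univ, hn]; simp)
  have hinj : Function.Injective fun i => radius (K i) := fun i j hij => by
    by_contra hne
    have h1 : (∑ i, Measure.dirac (K i)) {L | radius L = radius (K i)} ≤ 1 := by
      rw [← hK]
      exact (Measure.restrict_apply_le _ _).trans (hξ _)
    have h2 : (2 : ℝ≥0∞) ≤ (∑ i, Measure.dirac (K i)) {L | radius L = radius (K i)} := by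
      rw [Measure.finsetSum_apply]
      calc (2 : ℝ≥0∞) = ∑ l ∈ {i, j}, Measure.dirac (K l) {L | radius L = radius (K i)} := by
            rw [Finset.sum_pair hne, Measure.dirac_apply' _ (measurableSet_radius_eq _),
              Measure.dirac_apply' _ (measurableSet_radius_eq _)]
            have hij' : radius (K j) = radius (K i) := hij.symm
            simp [hij', one_add_one_eq_two]
        _ ≤ _ := Finset.sum_le_sum_of_subset (Finset.subset_univ _)
    exact absurd (h2.trans h1) (by norm_num)
  refine ⟨Finset.univ.image K, ?_, ?_⟩
  · intro x hx y hy hxy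
    simp only [Finset.coe_image, Finset.coe_univ, Set.image_univ, Set.mem_range] at hx hy
    obtain ⟨i, rfl⟩ := hx
    obtain ⟨j, rfl⟩ := hy
    rw [hinj hxy]
  · rw [hK, Finset.sum_image]
    exact fun i _ j _ h => hinj (congrArg radius h)

lemma lintegral_eq_sum_of_restrict {ξ : Conf d} {T : ℝ} {s : Finset (Particle d)}
    (hs : ξ.1.restrict {K | radius K ≤ T} = ∑ K ∈ s, Measure.dirac K) {h : Particle d → ℝ≥0∞}
    (h0 : ∀ K, T < radius K → h K = 0) : ∫⁻ K, h K ∂ξ.1 = ∑ K ∈ s, h K := by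
  have h1 : h = Set.indicator {K | radius K ≤ T} h := by
    ext K
    by_cases hK : radius K ≤ T
    · simp [hK]
    · simp [hK, h0 K (not_le.1 hK)]
  conv_lhs => rw [h1]
  rw [lintegral_indicator (measurableSet_radius_le T), hs, lintegral_finsetSum_measure]
  simp

/-- The predictable version of `κ`: its conditional expectation given the past, obtained as a
Radon–Nikodym derivative on the space of particles and pasts. -/
lemma exists_predictable_projection {P : Measure (Conf d)} [IsProbabilityMeasure P]
    {κ : Particle d × Conf d → ℝ≥0∞} (hκm : Measurable κ) (hκ : ∀ q, κ q ≤ 1)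
    {ν : Measure (Particle d)} (hν : RadiallyDiffuse ν) :
    ∃ k : Particle d × Conf d → ℝ≥0∞, Measurable k ∧ (∀ q, k q ≤ 1) ∧
      ∀ g : Particle d × Conf d → ℝ≥0∞, Measurable g →
        ∫⁻ ξ, ∫⁻ K, g (K, past (radius K) ξ) * κ (K, ξ) ∂ν ∂P =
          ∫⁻ ξ, ∫⁻ K, g (K, past (radius K) ξ) * k (K, past (radius K) ξ) ∂ν ∂P := by
  have := hν.sigmaFinite
  let Φ : Particle d × Conf d → Particle d × Conf d := fun q => (q.1, past (radius q.1) q.2)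
  have hΦ : Measurable Φ := measurable_fst.prodMk
    (measurable_past.comp ((measurable_radius.comp measurable_fst).prodMk measurable_snd))
  let m := (ν.prod P).map Φ
  let m' := ((ν.prod P).withDensity κ).map Φ
  have hle : m' ≤ m := by
    refine Measure.map_mono ?_ hΦ
    calc (ν.prod P).withDensity κ ≤ (ν.prod P).withDensity 1 :=
          withDensity_mono (Filter.Eventually.of_forall hκ)
      _ = ν.prod P := withDensity_one
  have hσ : ∀ m₁ : Measure (Particle d × Conf d), m₁ ≤ m → SigmaFinite m₁ := fun m₁ hm₁ => by
    refine ⟨⟨⟨fun n : ℕ => {q | radius q.1 ≤ n}, fun _ => trivial, fun n => ?_, ?_⟩⟩⟩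
    · refine (hm₁ _).trans_lt ?_
      have hmeas : MeasurableSet {q : Particle d × Conf d | radius q.1 ≤ n} :=
        measurable_fst (measurableSet_radius_le (n : ℝ))
      have h1 : Φ ⁻¹' {q | radius q.1 ≤ n} = {K | radius K ≤ n} ×ˢ Set.univ := by
        ext q; simp [Φ]
      rw [Measure.map_apply hΦ hmeas, h1, Measure.prod_prod, measure_univ, mul_one]
      exact hν.finite n
    · exact Set.eq_univ_of_forall fun q => Set.mem_iUnion.2 (exists_nat_ge (radius q.1))
  have := hσ m le_rfl
  have := hσ m' hle
  have hac : m' ≪ m := Measure.absolutelyContinuous_of_le hle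
  have hrn : m.withDensity (m'.rnDeriv m) = m' := Measure.withDensity_rnDeriv_eq m' m hac
  have hone : m'.rnDeriv m ≤ᵐ[m] 1 := Measure.rnDeriv_le_one_of_le hle
  let k : Particle d × Conf d → ℝ≥0∞ := fun q => min (m'.rnDeriv m q) 1
  have hk : Measurable k := (Measure.measurable_rnDeriv m' m).min measurable_const
  have hk' : m.withDensity k = m' := by
    rw [← hrn]
    refine withDensity_congr_ae ?_
    filter_upwards [hone] with q hq
    exact min_eq_left hq
  refine ⟨k, hk, fun q => min_le_right _ _, fun g hg => ?_⟩
  have h1 : ∫⁻ q, g q ∂m' = ∫⁻ ξ, ∫⁻ K, g (K, past (radius K) ξ) * κ (K, ξ) ∂ν ∂P := by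
    rw [lintegral_map hg hΦ, lintegral_withDensity_eq_lintegral_mul _ hκm
      (g := fun q => g (Φ q)) (hg.comp hΦ),
      lintegral_prod_symm (κ * fun q => g (Φ q)) (hκm.mul (hg.comp hΦ)).aemeasurable]
    simp [Φ, mul_comm]
  have h2 : ∫⁻ q, g q ∂m' =
      ∫⁻ ξ, ∫⁻ K, g (K, past (radius K) ξ) * k (K, past (radius K) ξ) ∂ν ∂P := by
    rw [← hk', lintegral_withDensity_eq_lintegral_mul _ hk hg, lintegral_map (hk.mul hg) hΦ,
      lintegral_prod_symm (fun q => (k * g) (Φ q)) ((hk.mul hg).comp hΦ).aemeasurable]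
    simp [Φ, mul_comm]
  rw [← h1, h2]

end GNZ

/-! ### The exponential formula for the compensated configuration -/

section Exponential

variable {d : ℕ}

/-- The function `1 - exp (-f)`. -/
def oneSubExp (f : Particle d → ℝ≥0) (K : Particle d) : ℝ≥0∞ :=
  ENNReal.ofReal (1 - Real.exp (-(f K : ℝ)))

lemma measurable_oneSubExp {f : Particle d → ℝ≥0} (hf : Measurable f) :
    Measurable (oneSubExp f) := by
  unfold oneSubExp
  fun_prop

lemma oneSubExp_le_one (f : Particle d → ℝ≥0) (K : Particle d) : oneSubExp f K ≤ 1 := by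
  refine ENNReal.ofReal_le_one.2 ?_
  have := Real.exp_pos (-(f K : ℝ))
  linarith

lemma oneSubExp_eq_zero {f : Particle d → ℝ≥0} {K : Particle d} (h : f K = 0) :
    oneSubExp f K = 0 := by
  simp [oneSubExp, h]

/-- The compensator `∫ 1{|L| < t} (1 - exp (-f L)) k (L, past of L) ν(dL)` up to time `t`. -/
def compensator (f : Particle d → ℝ≥0) (k : Particle d × Conf d → ℝ≥0∞)
    (ν : Measure (Particle d)) (t : ℝ) (ξ : Conf d) : ℝ≥0∞ :=
  ∫⁻ L, Set.indicator {L | radius L < t} (fun L => oneSubExp f L * k (L, past (radius L) ξ)) L ∂ν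

/-- The exponential martingale just before the particle `q.1` is revealed. -/
def expWeight (f : Particle d → ℝ≥0) (k : Particle d × Conf d → ℝ≥0∞) (ν : Measure (Particle d))
    (q : Particle d × Conf d) : ℝ≥0∞ :=
  ENNReal.ofReal (Real.exp (-(∫⁻ L, f L ∂(past (radius q.1) q.2).1).toReal +
    (compensator f k ν (radius q.1) q.2).toReal))

lemma expWeight_past (f : Particle d → ℝ≥0) (k : Particle d × Conf d → ℝ≥0∞)
    (ν : Measure (Particle d)) (K : Particle d) (ξ : Conf d) :
    expWeight f k ν (K, past (radius K) ξ) = expWeight f k ν (K, ξ) := by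
  have h : compensator f k ν (radius K) (past (radius K) ξ) = compensator f k ν (radius K) ξ := by
    refine lintegral_congr fun L => ?_
    by_cases hL : radius L < radius K
    · simp [hL, past_past hL.le]
    · simp [hL]
  simp only [expWeight, past_past le_rfl, h]

lemma expWeight_erase (f : Particle d → ℝ≥0) (k : Particle d × Conf d → ℝ≥0∞)
    (ν : Measure (Particle d)) (K : Particle d) (ξ : Conf d) :
    expWeight f k ν (K, erase ξ K) = expWeight f k ν (K, ξ) := by
  rw [← expWeight_past, past_erase, expWeight_past]

lemma measurable_predictable {k : Particle d × Conf d → ℝ≥0∞} (hk : Measurable k) :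
    Measurable fun q : Particle d × Conf d => k (q.1, past (radius q.1) q.2) :=
  hk.comp (measurable_fst.prodMk
    (measurable_past.comp ((measurable_radius.comp measurable_fst).prodMk measurable_snd)))

lemma measurable_expWeight {f : Particle d → ℝ≥0} (hf : Measurable f)
    {k : Particle d × Conf d → ℝ≥0∞} (hk : Measurable k) (ν : Measure (Particle d))
    [SFinite ν] : Measurable (expWeight f k ν) := by
  have h1 : Measurable fun q : Particle d × Conf d =>
      ∫⁻ L, f L ∂(past (radius q.1) q.2).1 :=
    measurable_lintegral_conf (f := fun _ L => (f L : ℝ≥0∞))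
      (measurable_past.comp ((measurable_radius.comp measurable_fst).prodMk measurable_snd))
      (hf.comp measurable_snd).coe_nnreal_ennreal
  have h2 : Measurable fun q : Particle d × Conf d => compensator f k ν (radius q.1) q.2 := by
    refine Measurable.lintegral_prod_right' (f := fun r : (Particle d × Conf d) × Particle d =>
      Set.indicator {L | radius L < radius r.1.1}
        (fun L => oneSubExp f L * k (L, past (radius L) r.1.2)) r.2) ?_
    have h3 : Measurable fun r : (Particle d × Conf d) × Particle d =>
        oneSubExp f r.2 * k (r.2, past (radius r.2) r.1.2) :=
      ((measurable_oneSubExp hf).comp measurable_snd).mul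
        ((measurable_predictable hk).comp
          (measurable_snd.prodMk (measurable_snd.comp measurable_fst)))
    exact h3.indicator (measurableSet_lt (measurable_radius.comp measurable_snd)
      (measurable_radius.comp (measurable_fst.comp measurable_fst)))
  unfold expWeight
  fun_prop

section Pathwise

variable {f : Particle d → ℝ≥0} {T : ℝ} {k : Particle d × Conf d → ℝ≥0∞} {ν : Measure (Particle d)}

lemma lintegral_oneSubExp_mul_le (hfT : ∀ K, T < radius K → f K = 0) {w : Particle d → ℝ≥0∞}
    (hw1 : ∀ K, w K ≤ 1) :
    ∫⁻ L, oneSubExp f L * w L ∂ν ≤ ν {K | radius K ≤ T} := by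
  rw [← lintegral_indicator_one (measurableSet_radius_le T)]
  refine lintegral_mono fun L => ?_
  by_cases hL : radius L ≤ T
  · simpa [hL] using mul_le_one' (oneSubExp_le_one f L) (hw1 L)
  · simp [oneSubExp_eq_zero (hfT L (not_le.1 hL))]

lemma compensator_le (hfT : ∀ K, T < radius K → f K = 0) (hk1 : ∀ q, k q ≤ 1) (t : ℝ)
    (ξ : Conf d) : compensator f k ν t ξ ≤ ν {K | radius K ≤ T} :=
  (lintegral_mono fun L => Set.indicator_le_self' (fun _ _ => zero_le) L).trans
    (lintegral_oneSubExp_mul_le hfT fun _ => hk1 _)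

lemma expWeight_le (hν : RadiallyDiffuse ν) (hfT : ∀ K, T < radius K → f K = 0)
    (hk1 : ∀ q, k q ≤ 1) (q : Particle d × Conf d) :
    expWeight f k ν q ≤ ENNReal.ofReal (Real.exp (ν.real {K | radius K ≤ T})) := by
  refine ENNReal.ofReal_le_ofReal (Real.exp_le_exp.2 ?_)
  have h1 := ENNReal.toReal_mono (hν.finite T).ne
    (compensator_le (ν := ν) hfT hk1 (radius q.1) q.2)
  have h2 : 0 ≤ (∫⁻ L, f L ∂(past (radius q.1) q.2).1).toReal := ENNReal.toReal_nonneg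
  unfold Measure.real
  linarith

/-- The exponential martingale starts at one, and is a stochastic integral against the difference
of the configuration and its compensator. -/
lemma exp_add_lintegral_expWeight (hf : Measurable f) (hk : Measurable k)
    (hν : RadiallyDiffuse ν) (hfT : ∀ K, T < radius K → f K = 0) (hk1 : ∀ q, k q ≤ 1)
    {ξ : Conf d} (hξ : ∀ t, ξ.1 {K | radius K = t} ≤ 1) :
    ENNReal.ofReal (Real.exp (-(∫⁻ L, f L ∂ξ.1).toReal +
        (∫⁻ L, oneSubExp f L * k (L, past (radius L) ξ) ∂ν).toReal)) +
      ∫⁻ K, expWeight f k ν (K, ξ) * oneSubExp f K ∂ξ.1 =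
    1 + ∫⁻ K, expWeight f k ν (K, ξ) * oneSubExp f K * k (K, past (radius K) ξ) ∂ν := by
  have := hν.sigmaFinite
  obtain ⟨s, hsinj, hs⟩ := exists_finset_of_radius_le_one hξ T
  have hρ : Measurable fun L => oneSubExp f L * k (L, past (radius L) ξ) :=
    (measurable_oneSubExp hf).mul ((measurable_predictable hk).comp measurable_prodMk_right)
  let β : Measure (Particle d) := ν.withDensity fun L => oneSubExp f L * k (L, past (radius L) ξ)
  have hβfin : IsFiniteMeasure β := ⟨by
    rw [withDensity_apply _ MeasurableSet.univ, Measure.restrict_univ]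
    exact (lintegral_oneSubExp_mul_le hfT fun _ => hk1 _).trans_lt (hν.finite T)⟩
  have hβ : ∀ t, β {K | radius K = t} = 0 := fun t =>
    withDensity_absolutelyContinuous _ _ (hν.null t)
  have hβt : ∀ t, β.real {L | radius L < t} = (compensator f k ν t ξ).toReal := fun t => by
    rw [Measure.real, withDensity_apply _ (measurableSet_radius_lt t), compensator,
      lintegral_indicator (measurableSet_radius_lt t)]
  have hw : ∀ K, weight f β s K = expWeight f k ν (K, ξ) := fun K => by
    have h1 : ∫⁻ L, f L ∂(past (radius K) ξ).1 =
        ∑ L ∈ s with radius L < radius K, (f L : ℝ≥0∞) := by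
      simp only [past]
      rw [← lintegral_indicator (measurableSet_radius_lt _), lintegral_eq_sum_of_restrict hs,
        Finset.sum_filter]
      · rfl
      · intro L hL
        simp [Set.indicator, hfT L hL]
    simp only [weight, expWeight, hβt, h1]
    rw [ENNReal.toReal_sum (by simp)]
    simp
  have h := exp_add_sum_weight f β hβ s hsinj
  have h1 : ∫⁻ L, f L ∂ξ.1 = ∑ L ∈ s, (f L : ℝ≥0∞) :=
    lintegral_eq_sum_of_restrict hs fun K hK => by simp [hfT K hK]
  have h2 : ∫⁻ K, expWeight f k ν (K, ξ) * oneSubExp f K ∂ξ.1 =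
      ∑ K ∈ s, weight f β s K * ENNReal.ofReal (1 - Real.exp (-(f K : ℝ))) := by
    rw [lintegral_eq_sum_of_restrict hs fun K hK => by simp [oneSubExp_eq_zero (hfT K hK)]]
    exact Finset.sum_congr rfl fun K _ => by rw [hw, oneSubExp]
  have h3 : β.real Set.univ = (∫⁻ L, oneSubExp f L * k (L, past (radius L) ξ) ∂ν).toReal := by
    rw [Measure.real, withDensity_apply _ MeasurableSet.univ, Measure.restrict_univ]
  have h4 : ∫⁻ K, weight f β s K ∂β =
      ∫⁻ K, expWeight f k ν (K, ξ) * oneSubExp f K * k (K, past (radius K) ξ) ∂ν := by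
    have hwm : Measurable fun K => weight f β s K := by
      simp only [hw]
      exact (measurable_expWeight hf hk ν).comp measurable_prodMk_right
    rw [lintegral_withDensity_eq_lintegral_mul _ hρ hwm]
    refine lintegral_congr fun K => ?_
    simp only [Pi.mul_apply, hw]
    ring
  rw [h1, h2, ← h3, ← h4, ← h, ENNReal.toReal_sum (by simp)]
  simp

end Pathwise

/-- The exponential martingale of a Gibbs process has expectation one. Here `k` is the predictable
projection of the Papangelou intensity `κ`. -/
lemma IsGNZ.lintegral_exp_eq_one {P : Measure (Conf d)} [IsProbabilityMeasure P]
    {κ : Particle d × Conf d → ℝ≥0∞} (hκ : ∀ q, κ q ≤ 1)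
    {ν : Measure (Particle d)} (hν : RadiallyDiffuse ν) (hP : IsGNZ P κ ν)
    {k : Particle d × Conf d → ℝ≥0∞} (hk : Measurable k) (hk1 : ∀ q, k q ≤ 1)
    (hproj : ∀ g : Particle d × Conf d → ℝ≥0∞, Measurable g →
        ∫⁻ ξ, ∫⁻ K, g (K, past (radius K) ξ) * κ (K, ξ) ∂ν ∂P =
          ∫⁻ ξ, ∫⁻ K, g (K, past (radius K) ξ) * k (K, past (radius K) ξ) ∂ν ∂P)
    {f : Particle d → ℝ≥0} (hf : Measurable f) {T : ℝ} (hfT : ∀ K, T < radius K → f K = 0) :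
    ∫⁻ ξ, ENNReal.ofReal (Real.exp (-(∫⁻ L, f L ∂ξ.1).toReal +
        (∫⁻ L, oneSubExp f L * k (L, past (radius L) ξ) ∂ν).toReal)) ∂P = 1 := by
  have := hν.sigmaFinite
  let F : Particle d × Conf d → ℝ≥0∞ := fun q => expWeight f k ν q * oneSubExp f q.1
  have hF : Measurable F :=
    (measurable_expWeight hf hk ν).mul ((measurable_oneSubExp hf).comp measurable_fst)
  have hm : Measurable fun ξ : Conf d => ∫⁻ K, F (K, ξ) ∂ξ.1 :=
    measurable_lintegral_conf measurable_id (f := fun ξ K => F (K, ξ)) (hF.comp measurable_swap)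
  have hm' : Measurable fun ξ : Conf d => ∫⁻ K, F (K, ξ) * k (K, past (radius K) ξ) ∂ν :=
    Measurable.lintegral_prod_right'
      (f := fun r : Conf d × Particle d => F (r.2, r.1) * k (r.2, past (radius r.2) r.1))
      ((hF.mul (measurable_predictable hk)).comp measurable_swap)
  have h1 : ∫⁻ ξ, ∫⁻ K, F (K, ξ) ∂ξ.1 ∂P =
      ∫⁻ ξ, ∫⁻ K, F (K, ξ) * k (K, past (radius K) ξ) ∂ν ∂P := by
    have ha := hP F hF
    have hb := hproj F hF
    simp only [F, expWeight_erase, expWeight_past] at ha hb ⊢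
    rw [ha, hb]
  have hfin : ∫⁻ ξ, ∫⁻ K, F (K, ξ) * k (K, past (radius K) ξ) ∂ν ∂P ≠ ∞ := by
    refine ne_top_of_le_ne_top (b := ENNReal.ofReal (Real.exp (ν.real {K | radius K ≤ T})) *
      ν {K | radius K ≤ T}) (ENNReal.mul_ne_top ENNReal.ofReal_ne_top (hν.finite T).ne) ?_
    calc ∫⁻ ξ, ∫⁻ K, F (K, ξ) * k (K, past (radius K) ξ) ∂ν ∂P
        ≤ ∫⁻ _ξ : Conf d, ENNReal.ofReal (Real.exp (ν.real {K | radius K ≤ T})) *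
            ν {K | radius K ≤ T} ∂P := by
          refine lintegral_mono fun ξ => ?_
          calc ∫⁻ K, F (K, ξ) * k (K, past (radius K) ξ) ∂ν
              ≤ ∫⁻ K, ENNReal.ofReal (Real.exp (ν.real {K | radius K ≤ T})) *
                  (oneSubExp f K * k (K, past (radius K) ξ)) ∂ν := by
                refine lintegral_mono fun K => ?_
                simp only [F, mul_assoc]
                gcongr
                exact expWeight_le hν hfT hk1 _
            _ ≤ _ := by
                rw [lintegral_const_mul' _ _ ENNReal.ofReal_ne_top]
                gcongr
                exact lintegral_oneSubExp_mul_le hfT fun _ => hk1 _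
      _ = _ := by simp
  have hsum : ∫⁻ ξ, ENNReal.ofReal (Real.exp (-(∫⁻ L, f L ∂ξ.1).toReal +
        (∫⁻ L, oneSubExp f L * k (L, past (radius L) ξ) ∂ν).toReal)) ∂P +
      ∫⁻ ξ, ∫⁻ K, F (K, ξ) ∂ξ.1 ∂P =
        1 + ∫⁻ ξ, ∫⁻ K, F (K, ξ) * k (K, past (radius K) ξ) ∂ν ∂P := by
    rw [← lintegral_add_right _ hm, show (1 : ℝ≥0∞) = ∫⁻ _ξ : Conf d, 1 ∂P by simp,
      ← lintegral_add_right _ hm']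
    refine lintegral_congr_ae ?_
    filter_upwards [hP.ae_radius_le_one hκ hν] with ξ hξ
    exact exp_add_lintegral_expWeight hf hk hν hfT hk1 hξ
  rw [h1] at hsum
  exact (ENNReal.add_left_inj hfin).1 hsum

end Exponential

/-! ### Poisson processes with independent marks -/

section Sampling

/-- The probability generating function of the Poisson distribution. -/
lemma lintegral_pow_poissonMeasure (r c : ℝ≥0) :
    ∫⁻ n, (c : ℝ≥0∞) ^ n ∂(poissonMeasure r) = ENNReal.ofReal (Real.exp ((r : ℝ) * c - r)) := by
  rw [poissonMeasure, lintegral_sum_measure]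
  simp only [lintegral_smul_measure, lintegral_dirac, smul_eq_mul]
  have h := (hasSum_one_poissonMeasure (r * c)).mul_left (Real.exp ((r : ℝ) * c - r))
  have h1 : ∀ n : ℕ, ENNReal.ofReal (Real.exp (-r) * r ^ n / n.factorial) * (c : ℝ≥0∞) ^ n =
      ENNReal.ofReal (Real.exp ((r : ℝ) * c - r) *
        (Real.exp (-((r * c : ℝ≥0) : ℝ)) * ((r * c : ℝ≥0) : ℝ) ^ n / n.factorial)) := fun n => by
    rw [← ENNReal.ofReal_coe_nnreal, ← ENNReal.ofReal_pow c.coe_nonneg,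
      ← ENNReal.ofReal_mul (by positivity)]
    congr 1
    rw [show Real.exp (-(r : ℝ)) = Real.exp ((r : ℝ) * c - r) * Real.exp (-((r : ℝ) * c)) by
      rw [← Real.exp_add]; congr 1; ring]
    push_cast
    rw [mul_pow]
    ring
  simp only [h1]
  rw [← ENNReal.ofReal_tsum_of_nonneg (fun n => by positivity) h.summable, h.tsum_eq, mul_one]

variable {S : Type*} [MeasurableSpace S] [Nonempty S]

open Classical in
/-- The normalization of `ρ`, and a point mass if `ρ = 0`. -/
def normalize (ρ : Measure S) : Measure S :=
  if ρ = 0 then Measure.dirac (Classical.arbitrary S) else (ρ Set.univ)⁻¹ • ρ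

instance (ρ : Measure S) [IsFiniteMeasure ρ] : IsProbabilityMeasure (normalize ρ) := by
  unfold normalize
  split_ifs with h
  · infer_instance
  · have : NeZero ρ := ⟨h⟩
    exact isProbabilityMeasureSMul

lemma smul_normalize (ρ : Measure S) [IsFiniteMeasure ρ] : ρ Set.univ • normalize ρ = ρ := by
  unfold normalize
  split_ifs with h
  · simp [h]
  · rw [smul_smul, ENNReal.mul_inv_cancel (by simpa using h) (measure_ne_top _ _), one_smul]

/-- A Poisson sample from a finite measure `ρ`: the number of points, and a sequence of independent
points of which as many are used as this number says. -/
def poissonSample (ρ : Measure S) : Measure (ℕ × (ℕ → S)) :=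
  (poissonMeasure (ρ Set.univ).toNNReal).prod (Measure.infinitePi fun _ : ℕ => normalize ρ)

instance (ρ : Measure S) [IsFiniteMeasure ρ] : IsProbabilityMeasure (poissonSample ρ) := by
  unfold poissonSample
  infer_instance

/-- The generating functional of a Poisson sample. -/
lemma lintegral_prod_poissonSample (ρ : Measure S) [IsFiniteMeasure ρ] {v : S → ℝ≥0∞}
    (hv : Measurable v) (hv1 : ∀ z, v z ≤ 1) :
    ∫⁻ ω, ∏ i ∈ Finset.range ω.1, v (ω.2 i) ∂(poissonSample ρ) =
      ENNReal.ofReal (Real.exp ((∫⁻ z, v z ∂ρ).toReal - ρ.real Set.univ)) := by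
  have hm : Measurable fun ω : ℕ × (ℕ → S) => ∏ i ∈ Finset.range ω.1, v (ω.2 i) := by
    refine measurable_from_prod_countable_right fun n => ?_
    exact Finset.measurable_prod (Finset.range n) fun i _ => hv.comp (measurable_pi_apply i)
  have hc : ∫⁻ z, v z ∂(normalize ρ) ≤ 1 := by
    calc ∫⁻ z, v z ∂(normalize ρ) ≤ ∫⁻ _z, 1 ∂(normalize ρ) := lintegral_mono hv1
      _ = 1 := by simp
  obtain ⟨c, hc'⟩ : ∃ c : ℝ≥0, (c : ℝ≥0∞) = ∫⁻ z, v z ∂(normalize ρ) :=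
    ⟨_, ENNReal.coe_toNNReal (ne_top_of_le_ne_top ENNReal.one_ne_top hc)⟩
  have hinner : ∀ n : ℕ, ∫⁻ z : ℕ → S, ∏ i ∈ Finset.range n, v (z i)
      ∂(Measure.infinitePi fun _ : ℕ => normalize ρ) = (c : ℝ≥0∞) ^ n := fun n => by
    rw [lintegral_prod_eq_prod_lintegral_of_indepFun (Finset.range n) (fun i (z : ℕ → S) => v (z i))
      (iIndepFun_infinitePi (X := fun _ => v) fun _ => hv)
      (fun i => hv.comp (measurable_pi_apply i))]
    have h : ∀ i : ℕ, ∫⁻ z : ℕ → S, v (z i) ∂(Measure.infinitePi fun _ : ℕ => normalize ρ) = c :=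
      fun i => by
        rw [hc', ← (measurePreserving_eval_infinitePi (fun _ : ℕ => normalize ρ) i).lintegral_comp
          hv]
    simp [h]
  rw [poissonSample, lintegral_prod _ hm.aemeasurable]
  simp only [hinner]
  rw [lintegral_pow_poissonMeasure]
  congr 3
  rw [← smul_normalize ρ, lintegral_smul_measure, smul_normalize, ← hc', smul_eq_mul,
    ENNReal.toReal_mul]
  rfl

end Sampling

section Marks

variable {d : ℕ}

/-- The uniform distribution on `[0, 1]`, from which the marks are drawn. -/
def uniformMark : Measure ℝ := volume.restrict (Set.Icc 0 1)

instance : IsProbabilityMeasure uniformMark := ⟨by simp [uniformMark]⟩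

/-- The shell of particles `K` with `n ≤ |K| < n + 1`. -/
def shell (d n : ℕ) : Set (Particle d) := {K | ⌊radius K⌋₊ = n}

lemma measurableSet_shell (n : ℕ) : MeasurableSet (shell d n) :=
  measurable_radius.nat_floor (measurableSet_singleton n)

lemma shell_subset (n : ℕ) : shell d n ⊆ {K | radius K ≤ (n + 1 : ℝ)} := fun K hK => by
  have h := Nat.lt_floor_add_one (radius K)
  rw [show ⌊radius K⌋₊ = n from hK] at h
  exact h.le

/-- In each shell, a number of marked particles and a sequence of marked particles. -/
abbrev MarkSpace (d : ℕ) : Type := ℕ → ℕ × (ℕ → Particle d × ℝ)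

/-- The law of a Poisson process with intensity measure `ν` and independent uniform marks,
sampled shell by shell. -/
def markLaw (ν : Measure (Particle d)) : Measure (MarkSpace d) :=
  Measure.infinitePi fun n => poissonSample ((ν.restrict (shell d n)).prod uniformMark)

lemma RadiallyDiffuse.isFiniteMeasure_shell {ν : Measure (Particle d)} (hν : RadiallyDiffuse ν)
    (n : ℕ) : IsFiniteMeasure (ν.restrict (shell d n)) :=
  ⟨by simpa using (measure_mono (shell_subset n)).trans_lt (hν.finite _)⟩

open Classical in
/-- The marked points of `ω` that lie in `D`, without their marks. Points outside of their shell,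
which do not occur almost surely, are discarded. -/
def markedPoints (D : Set (Particle d × ℝ)) (ω : MarkSpace d) : Measure (Particle d) :=
  Measure.sum fun n => ∑ i ∈ Finset.range (ω n).1 with
    (ω n).2 i ∈ D ∧ ((ω n).2 i).1 ∈ shell d n, Measure.dirac ((ω n).2 i).1

open Classical in
lemma lintegral_markedPoints (D : Set (Particle d × ℝ)) (ω : MarkSpace d)
    (h : Particle d → ℝ≥0∞) :
    ∫⁻ K, h K ∂(markedPoints D ω) = ∑' n, ∑ i ∈ Finset.range (ω n).1,
      if (ω n).2 i ∈ D ∧ ((ω n).2 i).1 ∈ shell d n then h ((ω n).2 i).1 else 0 := by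
  rw [markedPoints, lintegral_sum_measure]
  refine tsum_congr fun n => ?_
  rw [lintegral_finsetSum_measure, Finset.sum_filter]
  simp

/-- Only finitely many shells meet a bounded set. -/
lemma lintegral_markedPoints_eq_sum (D : Set (Particle d × ℝ)) (ω : MarkSpace d)
    {h : Particle d → ℝ≥0∞} {T : ℕ} (hT : ∀ K, (T : ℝ) < radius K → h K = 0) :
    ∫⁻ K, h K ∂(markedPoints D ω) =
      ∑ n ∈ Finset.range (T + 1), ∑ i ∈ Finset.range (ω n).1,
        Set.indicator {z : Particle d × ℝ | z ∈ D ∧ z.1 ∈ shell d n} (fun z => h z.1)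
          ((ω n).2 i) := by
  classical
  rw [lintegral_markedPoints, tsum_eq_sum (s := Finset.range (T + 1))]
  · simp [Set.indicator]
  · intro n hn
    refine Finset.sum_eq_zero fun i _ => ?_
    split_ifs with hi
    · refine hT _ ?_
      have h1 : ⌊radius ((ω n).2 i).1⌋₊ = n := hi.2
      have h2 := Nat.floor_le (radius_nonneg ((ω n).2 i).1)
      rw [h1] at h2
      refine lt_of_lt_of_le ?_ h2
      simp only [Finset.mem_range, not_lt] at hn
      exact_mod_cast hn
    · rfl

lemma isConf_markedPoints (D : Set (Particle d × ℝ)) (ω : MarkSpace d) :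
    IsConf (markedPoints D ω) := by
  classical
  refine ⟨fun A hA => ?_, fun K r => ?_⟩
  · rw [markedPoints, Measure.sum_apply _ hA]
    exact exists_enat_tsum fun n => (isConf_sum_dirac _ _).1 A hA
  · obtain ⟨T, hT⟩ := exists_nat_ge (r + radius K)
    have hsub : Metric.closedBall K r ⊆ {L | radius L ≤ T} := fun L hL => by
      have h := dist_triangle L K ({0} : Particle d)
      have h1 : dist L K ≤ r := hL
      have h2 : radius L ≤ r + radius K := h.trans (by unfold radius; gcongr)
      exact h2.trans hT
    refine (measure_mono hsub).trans_lt ?_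
    rw [← lintegral_indicator_one (measurableSet_radius_le _),
      lintegral_markedPoints_eq_sum D ω (T := T) fun L hL => by simp [hL]]
    refine ENNReal.sum_lt_top.2 fun n _ => ENNReal.sum_lt_top.2 fun i _ => ?_
    refine lt_of_le_of_lt (Set.indicator_le_self' (fun _ _ => zero_le) _) ?_
    refine lt_of_le_of_lt (Set.indicator_le_self' (fun _ _ => zero_le) _) ?_
    simp

/-- The number of marked points in `A` depends measurably on the retained marks. -/
lemma measurable_markedPoints_apply {α : Type*} [MeasurableSpace α]
    {D : Set (α × (Particle d × ℝ))} (hD : MeasurableSet D) {A : Set (Particle d)}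
    (hA : MeasurableSet A) :
    Measurable fun q : α × MarkSpace d => markedPoints {z | (q.1, z) ∈ D} q.2 A := by
  classical
  have h : (fun q : α × MarkSpace d => markedPoints {z | (q.1, z) ∈ D} q.2 A) = fun q =>
      ∑' n, ∑' i, if i < (q.2 n).1 ∧ (q.1, (q.2 n).2 i) ∈ D ∧ ((q.2 n).2 i).1 ∈ shell d n ∧
        ((q.2 n).2 i).1 ∈ A then (1 : ℝ≥0∞) else 0 := by
    funext q
    rw [← lintegral_indicator_one hA, lintegral_markedPoints]
    refine tsum_congr fun n => ?_
    rw [tsum_eq_sum (s := Finset.range (q.2 n).1) fun i hi => by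
      rw [if_neg]; exact fun h => hi (Finset.mem_range.2 h.1)]
    refine Finset.sum_congr rfl fun i hi => ?_
    have hi' : i < (q.2 n).1 := Finset.mem_range.1 hi
    by_cases h1 : ((q.2 n).2 i).1 ∈ A <;>
    by_cases h2 : (q.1, (q.2 n).2 i) ∈ D <;>
    by_cases h3 : ((q.2 n).2 i).1 ∈ shell d n <;> simp [h1, h2, h3, hi']
  rw [h]
  refine Measurable.tsum fun n => Measurable.tsum fun i => ?_
  have hN : Measurable fun q : α × MarkSpace d => (q.2 n).1 :=
    measurable_fst.comp ((measurable_pi_apply n).comp measurable_snd)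
  have hz : Measurable fun q : α × MarkSpace d => (q.2 n).2 i :=
    (measurable_pi_apply i).comp
      (measurable_snd.comp ((measurable_pi_apply n).comp measurable_snd))
  refine Measurable.ite ?_ measurable_const measurable_const
  refine (measurableSet_lt measurable_const hN).inter (MeasurableSet.inter ?_
    (MeasurableSet.inter ?_ ?_))
  · exact (measurable_fst.prodMk hz) hD
  · exact (measurable_fst.comp hz) (measurableSet_shell n)
  · exact (measurable_fst.comp hz) hA

lemma uniformMark_le {w : ℝ≥0∞} (hw : w ≤ 1) : uniformMark (Set.Iic w.toReal) = w := by
  have h1 : w.toReal ≤ 1 := ENNReal.toReal_le_of_le_ofReal zero_le_one (by simpa using hw)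
  have h : Set.Iic w.toReal ∩ Set.Icc (0 : ℝ) 1 = Set.Icc 0 w.toReal := by
    ext u
    simp only [Set.mem_inter_iff, Set.mem_Iic, Set.mem_Icc]
    exact ⟨fun h => ⟨h.2.1, h.1⟩, fun h => ⟨h.2, h.1, h.2.trans h1⟩⟩
  rw [uniformMark, Measure.restrict_apply measurableSet_Iic, h, Real.volume_Icc, sub_zero,
    ENNReal.ofReal_toReal (ne_top_of_le_ne_top ENNReal.one_ne_top hw)]

/-- Keeping each particle `K` with probability `w K` results in a Poisson process with intensity
measure `w • ν`. -/
lemma lintegral_exp_markedPoints {ν : Measure (Particle d)} (hν : RadiallyDiffuse ν)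
    {w : Particle d → ℝ≥0∞} (hw : Measurable w) (hw1 : ∀ K, w K ≤ 1)
    {f : Particle d → ℝ≥0} (hf : Measurable f) {T : ℕ} (hfT : ∀ K, (T : ℝ) < radius K → f K = 0) :
    ∫⁻ ω, ENNReal.ofReal (Real.exp
      (-(∫⁻ K, f K ∂(markedPoints {z | z.2 ≤ (w z.1).toReal} ω)).toReal)) ∂(markLaw ν) =
      ENNReal.ofReal (Real.exp (-(∫⁻ K, oneSubExp f K * w K ∂ν).toReal)) := by
  classical
  have := hν.isFiniteMeasure_shell
  set D : Set (Particle d × ℝ) := {z | z.2 ≤ (w z.1).toReal} with hD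
  have hDm : MeasurableSet D :=
    measurableSet_le measurable_snd (hw.ennreal_toReal.comp measurable_fst)
  let φ : ℕ → Particle d × ℝ → ℝ≥0 := fun n =>
    Set.indicator {z | z ∈ D ∧ z.1 ∈ shell d n} fun z => f z.1
  have hφ : ∀ n, Measurable (φ n) := fun n =>
    (hf.comp measurable_fst).indicator (hDm.inter (measurable_fst (measurableSet_shell n)))
  let v : ℕ → Particle d × ℝ → ℝ≥0∞ := fun n z => ENNReal.ofReal (Real.exp (-(φ n z : ℝ)))
  have hv : ∀ n, Measurable (v n) := fun n => by
    have := hφ n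
    fun_prop
  have hv1 : ∀ n z, v n z ≤ 1 := fun n z => by
    refine ENNReal.ofReal_le_one.2 (Real.exp_le_one_iff.2 ?_)
    simp
  let ρ : ℕ → Measure (Particle d × ℝ) := fun n => (ν.restrict (shell d n)).prod uniformMark
  have h1 : ∀ ω : MarkSpace d, ENNReal.ofReal (Real.exp
      (-(∫⁻ K, f K ∂(markedPoints D ω)).toReal)) =
        ∏ n ∈ Finset.range (T + 1), ∏ i ∈ Finset.range (ω n).1, v n ((ω n).2 i) := fun ω => by
    rw [lintegral_markedPoints_eq_sum D ω (T := T) fun K hK => by simp [hfT K hK]]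
    have h2 : ∀ n z, Set.indicator {z : Particle d × ℝ | z ∈ D ∧ z.1 ∈ shell d n}
        (fun z => (f z.1 : ℝ≥0∞)) z = (φ n z : ℝ≥0∞) := fun n z => by
      by_cases hz : z ∈ {z : Particle d × ℝ | z ∈ D ∧ z.1 ∈ shell d n} <;> simp [φ, hz]
    simp only [h2]
    rw [ENNReal.toReal_sum (fun n _ => ENNReal.sum_ne_top.2 fun i _ => ENNReal.coe_ne_top),
      ← Finset.sum_neg_distrib, Real.exp_sum,
      ENNReal.ofReal_prod_of_nonneg fun _ _ => (Real.exp_pos _).le]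
    refine Finset.prod_congr rfl fun n _ => ?_
    rw [ENNReal.toReal_sum (fun i _ => ENNReal.coe_ne_top), ← Finset.sum_neg_distrib, Real.exp_sum,
      ENNReal.ofReal_prod_of_nonneg fun _ _ => (Real.exp_pos _).le]
    rfl
  have hm : ∀ n, Measurable fun ω : ℕ × (ℕ → Particle d × ℝ) =>
      ∏ i ∈ Finset.range ω.1, v n (ω.2 i) := fun n => by
    refine measurable_from_prod_countable_right fun m => ?_
    exact Finset.measurable_prod (Finset.range m) fun i _ => (hv n).comp (measurable_pi_apply i)
  simp only [h1]
  rw [markLaw, lintegral_prod_eq_prod_lintegral_of_indepFun (Finset.range (T + 1))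
      (fun n (ω : MarkSpace d) => ∏ i ∈ Finset.range (ω n).1, v n ((ω n).2 i))
      (iIndepFun_infinitePi (P := fun n => poissonSample (ρ n))
        (X := fun n ω => ∏ i ∈ Finset.range ω.1, v n (ω.2 i)) hm)
      (fun n => (hm n).comp (measurable_pi_apply n))]
  have h3 : ∀ n, ∫⁻ ω : MarkSpace d, ∏ i ∈ Finset.range (ω n).1, v n ((ω n).2 i)
      ∂(Measure.infinitePi fun n => poissonSample (ρ n)) =
        ENNReal.ofReal (Real.exp (-(∫⁻ K in shell d n, oneSubExp f K * w K ∂ν).toReal)) :=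
    fun n => by
      rw [(measurePreserving_eval_infinitePi (fun n => poissonSample (ρ n)) n).lintegral_comp
        (hm n), lintegral_prod_poissonSample (ρ n) (hv n) (hv1 n)]
      congr 2
      have hone : ∀ z, (1 - v n z) + v n z = 1 := fun z => tsub_add_cancel_of_le (hv1 n z)
      have h4 : ∫⁻ z, (1 - v n z) ∂(ρ n) + ∫⁻ z, v n z ∂(ρ n) = ρ n Set.univ := by
        rw [← lintegral_add_right _ (hv n)]
        simp [hone]
      have hfin : ∫⁻ z, v n z ∂(ρ n) ≠ ∞ :=
        ne_top_of_le_ne_top (measure_ne_top (ρ n) Set.univ) (h4 ▸ le_add_self)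
      have hfin' : ∫⁻ z, (1 - v n z) ∂(ρ n) ≠ ∞ :=
        ne_top_of_le_ne_top (measure_ne_top (ρ n) Set.univ) (h4 ▸ le_self_add)
      have h5 : ∫⁻ z, (1 - v n z) ∂(ρ n) = ∫⁻ K in shell d n, oneSubExp f K * w K ∂ν := by
        rw [lintegral_prod (fun z => 1 - v n z) (measurable_const.sub (hv n)).aemeasurable]
        refine setLIntegral_congr_fun (measurableSet_shell n) fun K hK => ?_
        have h6 : ∀ u, 1 - v n (K, u) =
            Set.indicator (Set.Iic (w K).toReal) (fun _ => oneSubExp f K) u := fun u => by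
          by_cases hu : u ≤ (w K).toReal
          · have hmem : (K, u) ∈ {z : Particle d × ℝ | z ∈ D ∧ z.1 ∈ shell d n} := ⟨hu, hK⟩
            simp only [v, φ, Set.indicator_of_mem hmem, oneSubExp]
            rw [Set.indicator_of_mem (s := (Set.Iic (w K).toReal)) hu,
              ENNReal.ofReal_sub _ (Real.exp_pos _).le, ENNReal.ofReal_one]
          · have hmem : (K, u) ∉ {z : Particle d × ℝ | z ∈ D ∧ z.1 ∈ shell d n} :=
              fun h => hu h.1
            simp only [v, φ, Set.indicator_of_notMem hmem]
            rw [Set.indicator_of_notMem (s := (Set.Iic (w K).toReal)) hu]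
            simp
        simp only [h6]
        rw [lintegral_indicator_const measurableSet_Iic, uniformMark_le (hw1 K)]
      have h7 := congrArg ENNReal.toReal h4
      rw [ENNReal.toReal_add hfin' hfin, h5] at h7
      unfold Measure.real
      linarith
  rw [Finset.prod_congr rfl fun n _ => h3 n,
    ← ENNReal.ofReal_prod_of_nonneg fun _ _ => (Real.exp_pos _).le, ← Real.exp_sum,
    Finset.sum_neg_distrib]
  have hle : ∫⁻ K, oneSubExp f K * w K ∂ν ≤ ν {K | radius K ≤ T} :=
    lintegral_oneSubExp_mul_le hfT hw1
  rw [← ENNReal.toReal_sum fun n _ => ne_top_of_le_ne_top (hν.finite T).ne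
    ((setLIntegral_le_lintegral _ _).trans hle)]
  congr 4
  rw [← lintegral_biUnion_finset]
  · rw [← lintegral_indicator (Finset.measurableSet_biUnion _ fun n _ => measurableSet_shell n)]
    refine lintegral_congr fun K => ?_
    by_cases hK : K ∈ ⋃ n ∈ Finset.range (T + 1), shell d n
    · simp only [Set.indicator_of_mem hK]
    · rw [Set.indicator_of_notMem hK, oneSubExp_eq_zero, zero_mul]
      refine hfT K ?_
      simp only [Finset.mem_range, Set.mem_iUnion, shell, Set.mem_ofPred_eq, not_exists] at hK
      have : T + 1 ≤ ⌊radius K⌋₊ := by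
        by_contra hlt
        exact hK _ (not_le.1 hlt) rfl
      have h8 := Nat.floor_le (radius_nonneg K)
      have h9 : ((T + 1 : ℕ) : ℝ) ≤ ⌊radius K⌋₊ := by exact_mod_cast this
      push_cast at h9
      linarith
  · intro i _ j _ hij
    exact Set.disjoint_left.2 fun K hi hj => hij (hi.symm.trans hj)
  · exact fun n _ => measurableSet_shell n

end Marks

/-! ### Uniqueness of the law with a given Laplace functional -/

section Uniqueness

lemma exists_countable_isPiSystem (α : Type*) [m : MeasurableSpace α]
    [h : MeasurableSpace.CountablyGenerated α] :
    ∃ C : Set (Set α), C.Countable ∧ IsPiSystem C ∧ Set.univ ∈ C ∧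
      m = MeasurableSpace.generateFrom C := by
  obtain ⟨b, hb, hgen⟩ := h.isCountablyGenerated
  refine ⟨Set.sInter '' {F | F.Finite ∧ F ⊆ b}, (Set.countable_ofPred_finite_subset hb).image _,
    ?_, ⟨∅, ⟨Set.finite_empty, Set.empty_subset _⟩, Set.sInter_empty⟩, le_antisymm ?_ ?_⟩
  · rintro _ ⟨F, hF, rfl⟩ _ ⟨G, hG, rfl⟩ -
    exact ⟨F ∪ G, ⟨hF.1.union hG.1, Set.union_subset hF.2 hG.2⟩, Set.sInter_union F G⟩
  · rw [hgen]
    refine MeasurableSpace.generateFrom_mono fun s hs => ?_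
    exact ⟨{s}, ⟨Set.finite_singleton s, Set.singleton_subset_iff.2 hs⟩, Set.sInter_singleton s⟩
  · refine MeasurableSpace.generateFrom_le ?_
    rintro _ ⟨F, hF, rfl⟩
    refine MeasurableSet.sInter hF.1.countable fun s hs => ?_
    rw [hgen]
    exact MeasurableSpace.measurableSet_generateFrom (hF.2 hs)

variable {d : ℕ}

/-- The σ-field on configurations is generated by countably many counts in bounded sets. -/
lemma exists_countable_counts (d : ℕ) : ∃ A : ℕ → Set (Particle d), (∀ n, MeasurableSet (A n)) ∧
    (∀ n, ∃ T : ℕ, A n ⊆ {K | radius K ≤ T}) ∧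
      ∀ m : MeasurableSpace (Conf d), (∀ n, Measurable[m] fun ξ : Conf d => ξ.1 (A n)) →
        (Subtype.instMeasurableSpace : MeasurableSpace (Conf d)) ≤ m := by
  obtain ⟨C, hC, hpi, huniv, hgen⟩ := exists_countable_isPiSystem (Particle d)
  have : Countable C := hC
  have : Nonempty C := ⟨⟨_, huniv⟩⟩
  obtain ⟨e, he⟩ := exists_surjective_nat (C × ℕ)
  refine ⟨fun n => (e n).1 ∩ {K | radius K ≤ (e n).2}, fun n => ?_, fun n =>
    ⟨(e n).2, Set.inter_subset_right⟩, fun m hm => ?_⟩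
  · refine MeasurableSet.inter ?_ (measurableSet_radius_le _)
    rw [hgen]
    exact MeasurableSpace.measurableSet_generateFrom (e n).1.2
  have hbase : ∀ c ∈ C, ∀ N : ℕ, Measurable[m] fun ξ : Conf d => ξ.1 (c ∩ {K | radius K ≤ N}) :=
    fun c hc N => by
      obtain ⟨n, hn⟩ := he (⟨c, hc⟩, N)
      have h := hm n
      simp only [hn] at h
      exact h
  have hball : ∀ N : ℕ, Measurable[m] fun ξ : Conf d => ξ.1 {K | radius K ≤ N} := fun N => by
    simpa using hbase Set.univ huniv N
  have hN : ∀ N : ℕ, ∀ B : Set (Particle d), MeasurableSet B →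
      Measurable[m] fun ξ : Conf d => ξ.1 (B ∩ {K | radius K ≤ N}) := by
    intro N B hB
    induction B, hB using MeasurableSpace.induction_on_inter hgen hpi with
    | empty => simp
    | basic c hc => exact hbase c hc N
    | compl B hB ih =>
      have h : (fun ξ : Conf d => ξ.1 (Bᶜ ∩ {K | radius K ≤ N})) = fun ξ : Conf d =>
          ξ.1 {K | radius K ≤ N} - ξ.1 (B ∩ {K | radius K ≤ N}) := by
        funext ξ
        rw [← measure_sdiff Set.inter_subset_right
          (hB.inter (measurableSet_radius_le _)).nullMeasurableSet
          ((measure_mono Set.inter_subset_right).trans_lt (conf_radius_lt_top ξ N)).ne]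
        congr 1
        ext K; simp only [Set.mem_inter_iff, Set.mem_compl_iff, Set.mem_sdiff]; tauto
      rw [h]
      exact (hball N).sub ih
    | iUnion f hdisj hf ih =>
      have h : (fun ξ : Conf d => ξ.1 ((⋃ i, f i) ∩ {K | radius K ≤ N})) = fun ξ : Conf d =>
          ∑' i, ξ.1 (f i ∩ {K | radius K ≤ N}) := by
        funext ξ
        rw [Set.iUnion_inter, measure_iUnion
          (fun i j hij => (hdisj hij).mono Set.inter_subset_left Set.inter_subset_left)
          fun i => (hf i).inter (measurableSet_radius_le _)]
      rw [h]
      exact Measurable.tsum fun i => ih i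
  have hall : ∀ B : Set (Particle d), MeasurableSet B → Measurable[m] fun ξ : Conf d => ξ.1 B :=
    fun B hB => by
      have h : (fun ξ : Conf d => ξ.1 B) = fun ξ : Conf d =>
          ⨆ N : ℕ, ξ.1 (B ∩ {K | radius K ≤ N}) := by
        funext ξ
        have hmono : Monotone fun N : ℕ => B ∩ {K : Particle d | radius K ≤ N} := fun a b hab =>
          Set.inter_subset_inter_right _ fun K hK =>
            le_trans (show radius K ≤ a from hK) (by exact_mod_cast hab)
        rw [← hmono.measure_iUnion, ← Set.inter_iUnion, iUnion_radius_le, Set.inter_univ]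
      rw [h]
      exact Measurable.iSup fun N => hN N B hB
  have hid : @Measurable (Conf d) (Conf d) m Subtype.instMeasurableSpace id :=
    @measurable_conf_of_apply d (Conf d) m id hall
  exact fun s hs => hid hs

instance : MeasurableSpace.CountablyGenerated (Conf d) := by
  obtain ⟨A, hA, -, hgen⟩ := exists_countable_counts d
  let Φ : Conf d → ℕ → ℝ≥0∞ := fun ξ n => ξ.1 (A n)
  have h : (Subtype.instMeasurableSpace : MeasurableSpace (Conf d)) =
      MeasurableSpace.comap Φ inferInstance :=
    le_antisymm (hgen _ fun n => (measurable_pi_apply n).comp (comap_measurable Φ))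
      (measurable_pi_lambda Φ fun n => measurable_conf_apply (hA n)).comap_le
  rw [h]
  exact MeasurableSpace.CountablyGenerated.comap Φ

/-- A function with integer values that is bounded and vanishes outside of a bounded set. Integer
values are enough to determine laws, and make Laplace functionals depend on finitely many counts. -/
structure IsTestFunction (f : Particle d → ℕ) : Prop where
  measurable : Measurable f
  bounded : ∃ C, ∀ K, f K ≤ C
  bounded_support : ∃ T : ℕ, ∀ K, (T : ℝ) < radius K → f K = 0

lemma lintegral_conf_ne_top (ξ : Conf d) {f : Particle d → ℝ≥0} {C : ℝ≥0} (hC : ∀ K, f K ≤ C)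
    {T : ℝ} (hT : ∀ K, T < radius K → f K = 0) : ∫⁻ K, f K ∂ξ.1 ≠ ∞ := by
  refine ne_top_of_le_ne_top (b := C * ξ.1 {K | radius K ≤ T})
    (ENNReal.mul_ne_top ENNReal.coe_ne_top (conf_radius_lt_top ξ T).ne) ?_
  rw [← lintegral_indicator_const (measurableSet_radius_le T)]
  refine lintegral_mono fun K => ?_
  by_cases hK : radius K ≤ T
  · simpa [hK] using hC K
  · simp [hT K (not_le.1 hK)]

lemma IsTestFunction.lintegral_ne_top {f : Particle d → ℕ} (hf : IsTestFunction f) (ξ : Conf d) :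
    ∫⁻ K, (f K : ℝ≥0∞) ∂ξ.1 ≠ ∞ := by
  obtain ⟨C, hC⟩ := hf.bounded
  obtain ⟨T, hT⟩ := hf.bounded_support
  simpa using lintegral_conf_ne_top ξ (f := fun K => (f K : ℝ≥0)) (C := C)
    (fun K => by exact_mod_cast hC K) (T := T) fun K hK => by simp [hT K hK]

/-- The functional `ξ ↦ exp (-∫ f dξ)`. -/
def expFunctional (f : Particle d → ℕ) (ξ : Conf d) : ℝ :=
  Real.exp (-(∫⁻ K, (f K : ℝ≥0∞) ∂ξ.1).toReal)

lemma IsTestFunction.measurable_expFunctional {f : Particle d → ℕ} (hf : IsTestFunction f) :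
    Measurable (expFunctional f) := by
  have : Measurable fun ξ : Conf d => ∫⁻ K, (f K : ℝ≥0∞) ∂ξ.1 :=
    measurable_lintegral_conf measurable_id (f := fun _ K => (f K : ℝ≥0∞))
      ((measurable_from_top (f := fun n : ℕ => (n : ℝ≥0∞))).comp
        (hf.measurable.comp measurable_snd))
  unfold expFunctional
  fun_prop

lemma IsTestFunction.expFunctional_add {f g : Particle d → ℕ} (hf : IsTestFunction f)
    (hg : IsTestFunction g) (ξ : Conf d) :
    expFunctional (f + g) ξ = expFunctional f ξ * expFunctional g ξ := by
  have hm : Measurable fun K => (f K : ℝ≥0∞) :=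
    (measurable_from_top (f := fun n : ℕ => (n : ℝ≥0∞))).comp hf.measurable
  simp only [expFunctional, Pi.add_apply, Nat.cast_add]
  rw [lintegral_add_left hm, ENNReal.toReal_add (hf.lintegral_ne_top ξ) (hg.lintegral_ne_top ξ),
    neg_add, Real.exp_add]

lemma IsTestFunction.add {f g : Particle d → ℕ} (hf : IsTestFunction f)
    (hg : IsTestFunction g) : IsTestFunction (f + g) := by
  obtain ⟨C, hC⟩ := hf.bounded
  obtain ⟨T, hT⟩ := hf.bounded_support
  obtain ⟨C', hC'⟩ := hg.bounded
  obtain ⟨T', hT'⟩ := hg.bounded_support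
  refine ⟨hf.measurable.add hg.measurable, ⟨C + C', fun K => add_le_add (hC K) (hC' K)⟩,
    ⟨max T T', fun K hK => ?_⟩⟩
  push_cast at hK
  rw [max_lt_iff] at hK
  simp [hT K hK.1, hT' K hK.2]

lemma isTestFunction_indicator {A : Set (Particle d)} (hA : MeasurableSet A) {T : ℕ}
    (hT : A ⊆ {K | radius K ≤ T}) : IsTestFunction (A.indicator 1) := by
  refine ⟨measurable_one.indicator hA, ⟨1, fun K => Set.indicator_le_self' (by simp) K⟩,
    ⟨T, fun K hK => ?_⟩⟩
  exact Set.indicator_of_notMem (fun h => absurd (hT h) (not_le.2 hK)) _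

lemma expFunctional_indicator {A : Set (Particle d)} (hA : MeasurableSet A) (ξ : Conf d) :
    expFunctional (A.indicator 1) ξ = Real.exp (-(ξ.1 A).toReal) := by
  rw [expFunctional, ← lintegral_indicator_one hA]
  congr 3
  refine lintegral_congr fun K => ?_
  by_cases hK : K ∈ A <;> simp [hK]

open BoundedContinuousFunction in
/-- The law of a random configuration is determined by its Laplace functional. The proof embeds
configurations into the compact space `[0, 1]^ℕ`, through `exp (-ξ A)` for countably many `A`, and
uses that polynomials in the coordinates determine a measure there. -/
lemma eq_of_lintegral_expFunctional_eq {P₁ P₂ : Measure (Conf d)} [IsProbabilityMeasure P₁]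
    [IsProbabilityMeasure P₂]
    (h : ∀ f : Particle d → ℕ, IsTestFunction f →
      ∫⁻ ξ, ENNReal.ofReal (expFunctional f ξ) ∂P₁ =
        ∫⁻ ξ, ENNReal.ofReal (expFunctional f ξ) ∂P₂) : P₁ = P₂ := by
  obtain ⟨A, hA, hAT, hgen⟩ := exists_countable_counts d
  let Ψ : Conf d → ℕ → unitInterval := fun ξ n =>
    ⟨Real.exp (-(ξ.1 (A n)).toReal), (Real.exp_pos _).le, Real.exp_le_one_iff.2 (by simp)⟩
  have hΨ : Measurable Ψ := by
    refine measurable_pi_lambda _ fun n => Measurable.subtype_mk ?_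
    have := measurable_conf_apply (hA n)
    fun_prop
  let coord : ℕ → ((ℕ → unitInterval) →ᵇ ℝ) := fun n =>
    mkOfCompact ⟨fun x => (x n : ℝ), by fun_prop⟩
  let 𝒜 : StarSubalgebra ℝ ((ℕ → unitInterval) →ᵇ ℝ) :=
    { Algebra.adjoin ℝ (Set.range coord) with
      star_mem' := fun {g} hg => by
        have : star g = g := by ext x; simp
        rw [this]; exact hg }
  have hmono : ∀ g ∈ Submonoid.closure (Set.range coord), ∃ f : Particle d → ℕ,
      IsTestFunction f ∧ ∀ ξ, g (Ψ ξ) = expFunctional f ξ := by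
    intro g hg
    induction hg using Submonoid.closure_induction with
    | mem g hg =>
      obtain ⟨n, rfl⟩ := hg
      obtain ⟨T, hT⟩ := hAT n
      exact ⟨_, isTestFunction_indicator (hA n) hT, fun ξ =>
        (expFunctional_indicator (hA n) ξ).symm⟩
    | one =>
      exact ⟨0, ⟨measurable_const, ⟨0, by simp⟩, ⟨0, by simp⟩⟩, fun ξ => by simp [expFunctional]⟩
    | mul g g' _ _ ih ih' =>
      obtain ⟨f, hf, hfg⟩ := ih
      obtain ⟨f', hf', hfg'⟩ := ih'
      exact ⟨f + f', hf.add hf', fun ξ => by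
        rw [hf.expFunctional_add hf', ← hfg, ← hfg', BoundedContinuousFunction.mul_apply]⟩
  have hint : ∀ g ∈ Submonoid.closure (Set.range coord),
      ∫ x, g x ∂(P₁.map Ψ) = ∫ x, g x ∂(P₂.map Ψ) := by
    intro g hg
    obtain ⟨f, hf, hfg⟩ := hmono g hg
    have hpos : ∀ P : Measure (Conf d), 0 ≤ᵐ[P] expFunctional f := fun P =>
      Filter.Eventually.of_forall fun ξ => (Real.exp_pos _).le
    rw [integral_map hΨ.aemeasurable g.continuous.aestronglyMeasurable,
      integral_map hΨ.aemeasurable g.continuous.aestronglyMeasurable]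
    simp only [hfg]
    rw [integral_eq_lintegral_of_nonneg_ae (hpos _)
      hf.measurable_expFunctional.aestronglyMeasurable, integral_eq_lintegral_of_nonneg_ae (hpos _)
      hf.measurable_expFunctional.aestronglyMeasurable, h f hf]
  have hP1 := Measure.isProbabilityMeasure_map (μ := P₁) hΨ.aemeasurable
  have hP2 := Measure.isProbabilityMeasure_map (μ := P₂) hΨ.aemeasurable
  have hmap : P₁.map Ψ = P₂.map Ψ := by
    refine ext_of_forall_mem_subalgebra_integral_eq_of_polish (𝕜 := ℝ) (A := 𝒜) ?_ ?_
    · intro x y hxy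
      obtain ⟨n, hn⟩ := Function.ne_iff.1 hxy
      refine ⟨coord n, ⟨_, ⟨coord n, Algebra.subset_adjoin ⟨n, rfl⟩, rfl⟩, rfl⟩, ?_⟩
      exact fun h => hn (Subtype.ext h)
    · intro g hg
      have hg' : g ∈ Subalgebra.toSubmodule (Algebra.adjoin ℝ (Set.range coord)) := hg
      clear hg
      rw [Algebra.adjoin_eq_span] at hg'
      induction hg' using Submodule.span_induction with
      | mem g hg => exact hint g hg
      | zero => simp
      | add g g' _ _ ih ih' =>
        simp only [BoundedContinuousFunction.add_apply]
        rw [integral_add (g.integrable _) (g'.integrable _),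
          integral_add (g.integrable _) (g'.integrable _), ih, ih']
      | smul c g _ ih =>
        simp only [BoundedContinuousFunction.smul_apply, integral_smul, ih]
  have hcomap : (Subtype.instMeasurableSpace : MeasurableSpace (Conf d)) ≤
      MeasurableSpace.comap Ψ inferInstance := by
    refine hgen _ fun n => ?_
    have hn : (fun ξ : Conf d => ξ.1 (A n)) =
        (fun x : ℕ → unitInterval => ENNReal.ofReal (-Real.log (x n))) ∘ Ψ := by
      funext ξ
      obtain ⟨T, hT⟩ := hAT n
      have hfin : ξ.1 (A n) ≠ ∞ := ((measure_mono hT).trans_lt (conf_radius_lt_top ξ T)).ne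
      simp [Ψ, ENNReal.ofReal_toReal hfin]
    rw [hn]
    refine Measurable.comp ?_ (comap_measurable Ψ)
    have : Measurable fun x : ℕ → unitInterval => (x n : ℝ) :=
      measurable_subtype_coe.comp (measurable_pi_apply n)
    fun_prop
  refine Measure.ext fun s hs => ?_
  obtain ⟨t, ht, rfl⟩ := hcomap s hs
  rw [← Measure.map_apply hΨ ht, ← Measure.map_apply hΨ ht, hmap]

end Uniqueness

/-! ### Comparison with the Poisson process -/

section Comparison

variable {d : ℕ}

/-- The Laplace functional of a Poisson process. -/
lemma IsPoissonProcess.lintegral_expFunctional {Ω : Type*} [MeasurableSpace Ω] {P : Measure Ω}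
    {X : Ω → Conf d} {ν : Measure (Particle d)} (hX : IsPoissonProcess P X ν)
    (hν : RadiallyDiffuse ν) {f : Particle d → ℕ} (hf : IsTestFunction f) :
    ∫⁻ ω, ENNReal.ofReal (expFunctional f (X ω)) ∂P =
      ENNReal.ofReal (Real.exp (-(∫⁻ K, oneSubExp (fun K => (f K : ℝ≥0)) K ∂ν).toReal)) := by
  obtain ⟨C, hC⟩ := hf.bounded
  obtain ⟨T, hT⟩ := hf.bounded_support
  let A : Fin C → Set (Particle d) := fun j => {K | f K = j + 1}
  have hA : ∀ j, MeasurableSet (A j) := fun j => hf.measurable (measurableSet_singleton _)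
  have hAT : ∀ j, A j ⊆ {K | radius K ≤ T} := fun j K hK => by
    by_contra hlt
    have h1 : f K = j + 1 := hK
    rw [hT K (not_le.1 hlt)] at h1
    omega
  have hdecomp : ∀ (h : ℕ → ℝ≥0∞), h 0 = 0 → ∀ ξ : Measure (Particle d),
      ∫⁻ K, h (f K) ∂ξ = ∑ j : Fin C, h (j + 1) * ξ (A j) := fun h h0 ξ => by
    have h1 : ∀ K, h (f K) = ∑ j : Fin C, (A j).indicator (fun _ => h (j + 1)) K := fun K => by
      rcases Nat.eq_zero_or_pos (f K) with hK | hK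
      · rw [hK, h0, Finset.sum_eq_zero fun j _ => ?_]
        refine Set.indicator_of_notMem (fun hj => ?_) _
        have : f K = j + 1 := hj
        omega
      · have hlt : f K - 1 < C := by have := hC K; omega
        rw [Finset.sum_eq_single ⟨f K - 1, hlt⟩]
        · have hmem : K ∈ A ⟨f K - 1, hlt⟩ := by simp only [A, Set.mem_ofPred_eq]; omega
          rw [Set.indicator_of_mem hmem]
          exact congrArg h hmem
        · intro j _ hj
          refine Set.indicator_of_notMem (fun hj' => hj (Fin.ext ?_)) _
          have : f K = j + 1 := hj'
          simp only
          omega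
        · simp
    simp only [h1]
    rw [lintegral_finsetSum _ fun j _ => measurable_const.indicator (hA j)]
    exact Finset.sum_congr rfl fun j _ => lintegral_indicator_const (hA j) _
  have hνA : ∀ j, ν (A j) ≠ ∞ := fun j => ((measure_mono (hAT j)).trans_lt (hν.finite T)).ne
  let φ : Fin C → ℝ≥0∞ → ℝ≥0∞ := fun j x => ENNReal.ofReal (Real.exp (-((j + 1 : ℝ) * x.toReal)))
  have hφ : ∀ j, Measurable (φ j) := fun j => by fun_prop
  have h1 : ∀ ω, ENNReal.ofReal (expFunctional f (X ω)) = ∏ j, φ j ((X ω).1 (A j)) := fun ω => by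
    have hfin : ∀ j, (X ω).1 (A j) ≠ ∞ := fun j =>
      ((measure_mono (hAT j)).trans_lt (conf_radius_lt_top _ T)).ne
    rw [expFunctional, hdecomp (fun n => (n : ℝ≥0∞)) (by simp), ENNReal.toReal_sum
      (fun j _ => ENNReal.mul_ne_top (ENNReal.natCast_ne_top _) (hfin j)),
      ← Finset.sum_neg_distrib, Real.exp_sum,
      ENNReal.ofReal_prod_of_nonneg fun _ _ => (Real.exp_pos _).le]
    refine Finset.prod_congr rfl fun j _ => ?_
    simp only [φ, ENNReal.toReal_mul, ENNReal.toReal_natCast]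
    push_cast
    rfl
  have hXA : ∀ j, Measurable fun ω => (X ω).1 (A j) := fun j =>
    (measurable_conf_apply (hA j)).comp hX.measurable
  have hdisj : Pairwise fun i j => Disjoint (A i) (A j) := fun i j hij =>
    Set.disjoint_left.2 fun K hi hj => hij (Fin.ext (by
      have h2 : f K = i + 1 := hi
      have h3 : f K = j + 1 := hj
      omega))
  have h2 : ∀ j, ∫⁻ ω, φ j ((X ω).1 (A j)) ∂P =
      ENNReal.ofReal (Real.exp (-((1 - Real.exp (-(j + 1 : ℝ))) * (ν (A j)).toReal))) := fun j => by
    rw [← lintegral_map (hφ j) (hXA j), hX.count_of_ne_top _ (hA j) (hνA j),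
      lintegral_map (hφ j) measurable_from_top]
    have h3 : ∀ n : ℕ, φ j (n : ℝ≥0∞) = (((Real.exp (-(j + 1 : ℝ))).toNNReal : ℝ≥0) : ℝ≥0∞) ^ n :=
      fun n => by
        simp only [φ, ENNReal.toReal_natCast]
        rw [← ENNReal.ofReal, ← ENNReal.ofReal_pow (Real.exp_pos _).le, ← Real.exp_nat_mul]
        congr 2; ring
    simp only [h3]
    rw [lintegral_pow_poissonMeasure, Real.coe_toNNReal _ (Real.exp_pos _).le,
      ENNReal.coe_toNNReal_eq_toReal]
    congr 2; ring
  simp only [h1]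
  rw [lintegral_prod_eq_prod_lintegral_of_indepFun Finset.univ
      (fun j ω => φ j ((X ω).1 (A j))) ((hX.indep C A hA hdisj).comp φ hφ)
      (fun j => (hφ j).comp (hXA j)), Finset.prod_congr rfl fun j _ => h2 j,
    ← ENNReal.ofReal_prod_of_nonneg fun _ _ => (Real.exp_pos _).le, ← Real.exp_sum,
    Finset.sum_neg_distrib]
  have h4 := hdecomp (fun n => ENNReal.ofReal (1 - Real.exp (-(n : ℝ)))) (by simp) ν
  have h5 : ∫⁻ K, oneSubExp (fun K => (f K : ℝ≥0)) K ∂ν =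
      ∑ j : Fin C, ENNReal.ofReal (1 - Real.exp (-((j + 1 : ℕ) : ℝ))) * ν (A j) := by
    rw [← h4]
    simp [oneSubExp]
  rw [h5, ENNReal.toReal_sum (fun j _ => ENNReal.mul_ne_top ENNReal.ofReal_ne_top (hνA j))]
  congr 4
  funext j
  rw [ENNReal.toReal_mul, ENNReal.toReal_ofReal]
  · push_cast; rfl
  · have : Real.exp (-((j + 1 : ℕ) : ℝ)) ≤ 1 := Real.exp_le_one_iff.2 (by
      rw [neg_nonpos]; exact Nat.cast_nonneg _)
    linarith

/-- The marks below which a marked particle is added to `ξ`: given `ξ`, the particle `K` is added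
with probability one minus the predictable intensity. -/
def acceptance (k : Particle d × Conf d → ℝ≥0∞) : Set (Conf d × (Particle d × ℝ)) :=
  {r | r.2.2 ≤ (1 - k (r.2.1, past (radius r.2.1) r.1)).toReal}

lemma measurableSet_acceptance {k : Particle d × Conf d → ℝ≥0∞} (hk : Measurable k) :
    MeasurableSet (acceptance k) := by
  have h : Measurable fun r : Conf d × (Particle d × ℝ) => k (r.2.1, past (radius r.2.1) r.1) :=
    (measurable_predictable hk).comp ((measurable_fst.comp measurable_snd).prodMk measurable_fst)
  exact measurableSet_le (measurable_snd.comp measurable_snd)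
    (measurable_const.sub h).ennreal_toReal

/-- The configuration `ξ` together with the accepted marked points: the superposition that turns
a Gibbs process into a Poisson process. -/
def completion (k : Particle d × Conf d → ℝ≥0∞) (q : Conf d × MarkSpace d) : Conf d :=
  ⟨q.1.1 + markedPoints {z | (q.1, z) ∈ acceptance k} q.2, q.1.2.add (isConf_markedPoints _ _)⟩

lemma le_completion (k : Particle d × Conf d → ℝ≥0∞) (q : Conf d × MarkSpace d) :
    q.1 ≤ completion k q :=
  show q.1.1 ≤ q.1.1 + markedPoints {z | (q.1, z) ∈ acceptance k} q.2 from
    Measure.le_add_right le_rfl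

lemma measurable_completion {k : Particle d × Conf d → ℝ≥0∞} (hk : Measurable k) :
    Measurable (completion k) :=
  measurable_conf_of_apply fun _ hA => ((measurable_conf_apply hA).comp measurable_fst).add
    (measurable_markedPoints_apply (measurableSet_acceptance hk) hA)

/-- The completion of a Gibbs process has the Laplace functional of a Poisson process. -/
lemma IsGNZ.lintegral_expFunctional_completion {P : Measure (Conf d)} [IsProbabilityMeasure P]
    {κ : Particle d × Conf d → ℝ≥0∞} (hκ : ∀ q, κ q ≤ 1)
    {ν : Measure (Particle d)} (hν : RadiallyDiffuse ν) (hP : IsGNZ P κ ν)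
    {k : Particle d × Conf d → ℝ≥0∞} (hk : Measurable k) (hk1 : ∀ q, k q ≤ 1)
    (hproj : ∀ g : Particle d × Conf d → ℝ≥0∞, Measurable g →
        ∫⁻ ξ, ∫⁻ K, g (K, past (radius K) ξ) * κ (K, ξ) ∂ν ∂P =
          ∫⁻ ξ, ∫⁻ K, g (K, past (radius K) ξ) * k (K, past (radius K) ξ) ∂ν ∂P)
    {f : Particle d → ℕ} (hf : IsTestFunction f) :
    ∫⁻ ξ, ENNReal.ofReal (expFunctional f ξ) ∂((P.prod (markLaw ν)).map (completion k)) =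
      ENNReal.ofReal (Real.exp (-(∫⁻ K, oneSubExp (fun K => (f K : ℝ≥0)) K ∂ν).toReal)) := by
  have := hν.isFiniteMeasure_shell
  have : IsProbabilityMeasure (markLaw ν) := by unfold markLaw; infer_instance
  obtain ⟨T, hT⟩ := hf.bounded_support
  set F : Particle d → ℝ≥0 := fun K => (f K : ℝ≥0) with hF
  have hFm : Measurable F :=
    (measurable_from_top (f := fun n : ℕ => (n : ℝ≥0))).comp hf.measurable
  have hFT : ∀ K, (T : ℝ) < radius K → F K = 0 := fun K hK => by simp [F, hT K hK]
  have hm : Measurable fun ξ => ENNReal.ofReal (expFunctional f ξ) :=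
    hf.measurable_expFunctional.ennreal_ofReal
  rw [lintegral_map hm (measurable_completion hk),
    lintegral_prod (fun q => ENNReal.ofReal (expFunctional f (completion k q)))
      (hm.comp (measurable_completion hk)).aemeasurable]
  have hcast : ∀ K, (f K : ℝ≥0∞) = (F K : ℝ≥0∞) := fun K => by simp [F]
  have hinner : ∀ ξ : Conf d,
      ∫⁻ ω, ENNReal.ofReal (expFunctional f (completion k (ξ, ω))) ∂(markLaw ν) =
        ENNReal.ofReal (Real.exp (-(∫⁻ K, oneSubExp F K ∂ν).toReal)) *
        ENNReal.ofReal (Real.exp (-(∫⁻ L, F L ∂ξ.1).toReal +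
          (∫⁻ L, oneSubExp F L * k (L, past (radius L) ξ) ∂ν).toReal)) := fun ξ => by
    have hkξ : Measurable fun K => k (K, past (radius K) ξ) :=
      (measurable_predictable hk).comp measurable_prodMk_right
    have h1 : ∀ ω, ENNReal.ofReal (expFunctional f (completion k (ξ, ω))) =
        ENNReal.ofReal (Real.exp (-(∫⁻ L, F L ∂ξ.1).toReal)) * ENNReal.ofReal (Real.exp
          (-(∫⁻ K, F K ∂(markedPoints {z | z.2 ≤ (1 - k (z.1, past (radius z.1) ξ)).toReal}
            ω)).toReal)) := fun ω => by
      have ha := hf.lintegral_ne_top ξ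
      have hb := hf.lintegral_ne_top ⟨_, isConf_markedPoints
        {z | z.2 ≤ (1 - k (z.1, past (radius z.1) ξ)).toReal} ω⟩
      simp only [hcast] at ha hb
      rw [← ENNReal.ofReal_mul (Real.exp_pos _).le, ← Real.exp_add, ← neg_add,
        ← ENNReal.toReal_add ha hb, ← lintegral_add_measure, expFunctional]
      simp only [hcast]
      rfl
    simp only [h1]
    rw [lintegral_const_mul' _ _ ENNReal.ofReal_ne_top,
      lintegral_exp_markedPoints hν (w := fun K => 1 - k (K, past (radius K) ξ))
        (measurable_const.sub hkξ) (fun K => tsub_le_self) hFm hFT,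
      ← ENNReal.ofReal_mul (Real.exp_pos _).le, ← ENNReal.ofReal_mul (Real.exp_pos _).le,
      ← Real.exp_add, ← Real.exp_add]
    congr 2
    have hsplit : ∫⁻ K, oneSubExp F K * (1 - k (K, past (radius K) ξ)) ∂ν +
        ∫⁻ K, oneSubExp F K * k (K, past (radius K) ξ) ∂ν = ∫⁻ K, oneSubExp F K ∂ν := by
      have hm2 : Measurable fun K => oneSubExp F K * k (K, past (radius K) ξ) :=
        (measurable_oneSubExp hFm).mul hkξ
      rw [← lintegral_add_right _ hm2]
      refine lintegral_congr fun K => ?_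
      rw [← mul_add, tsub_add_cancel_of_le (hk1 _), mul_one]
    have hfin1 : ∫⁻ K, oneSubExp F K * (1 - k (K, past (radius K) ξ)) ∂ν ≠ ∞ :=
      ((lintegral_oneSubExp_mul_le hFT fun K => tsub_le_self).trans_lt (hν.finite T)).ne
    have hfin2 : ∫⁻ K, oneSubExp F K * k (K, past (radius K) ξ) ∂ν ≠ ∞ :=
      ((lintegral_oneSubExp_mul_le hFT fun K => hk1 _).trans_lt (hν.finite T)).ne
    rw [← hsplit, ENNReal.toReal_add hfin1 hfin2]
    ring
  simp only [hinner]
  rw [lintegral_const_mul' _ _ ENNReal.ofReal_ne_top,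
    hP.lintegral_exp_eq_one hκ hν hk hk1 hproj hFm hFT, mul_one]

/-- A law that satisfies the GNZ equation with a Papangelou intensity bounded by one is dominated by
a Poisson process. -/
theorem IsGNZ.stochDominated {P : Measure (Conf d)} [IsProbabilityMeasure P]
    {κ : Particle d × Conf d → ℝ≥0∞} (hκm : Measurable κ) (hκ : ∀ q, κ q ≤ 1)
    {ν : Measure (Particle d)} (hν : RadiallyDiffuse ν) (hP : IsGNZ P κ ν)
    {Ω : Type*} [MeasurableSpace Ω] {P' : Measure Ω} [IsProbabilityMeasure P'] {X : Ω → Conf d}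
    (hX : IsPoissonProcess P' X ν) : StochDominated P (P'.map X) := by
  have := hν.isFiniteMeasure_shell
  have : IsProbabilityMeasure (markLaw ν) := by unfold markLaw; infer_instance
  obtain ⟨k, hk, hk1, hproj⟩ := exists_predictable_projection (P := P) hκm hκ hν
  have hcm := measurable_completion hk
  have := Measure.isProbabilityMeasure_map (μ := P.prod (markLaw ν)) hcm.aemeasurable
  have := Measure.isProbabilityMeasure_map (μ := P') hX.measurable.aemeasurable
  have hlaw : (P.prod (markLaw ν)).map (completion k) = P'.map X := by
    refine eq_of_lintegral_expFunctional_eq fun f hf => ?_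
    rw [hP.lintegral_expFunctional_completion hκ hν hk hk1 hproj hf,
      lintegral_map hf.measurable_expFunctional.ennreal_ofReal hX.measurable,
      hX.lintegral_expFunctional hν hf]
  intro E hE hup
  rw [← hlaw, Measure.map_apply hcm hE]
  calc P E = (P.prod (markLaw ν)) (E ×ˢ Set.univ) := by
        rw [Measure.prod_prod, measure_univ, mul_one]
    _ ≤ (P.prod (markLaw ν)) (completion k ⁻¹' E) :=
        measure_mono fun q hq => hup (le_completion k q) hq.1

end Comparison

/-! ### Configurations without multiple points -/

section Simple

variable {d p : ℕ}

lemma singleton_le_of_radius {ξ : Conf d} (hξ : ∀ t, ξ.1 {K | radius K = t} ≤ 1) (L : Particle d) :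
    ξ.1 {L} ≤ 1 :=
  (measure_mono (t := {K | radius K = radius L}) (Set.singleton_subset_iff.2 rfl)).trans
    (hξ (radius L))

/-- In the absence of multiple points, removing a point is a restriction. -/
lemma erase_eq_restrict {ξ : Conf d} (hξ : ∀ L, ξ.1 {L} ≤ 1) (L : Particle d) :
    (erase ξ L).1 = ξ.1.restrict {L}ᶜ := by
  refine Measure.ext fun A hA => ?_
  have hL : MeasurableSet ({L} : Set (Particle d)) := measurableSet_singleton L
  rw [Measure.restrict_apply hA]
  rcases ξ.2.eq_zero_or_one_le L with h | h
  · simp only [erase, sub_dirac_of_eq_zero h]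
    exact (measure_sdiff_null h).symm
  · have h1 : ξ.1 {L} = 1 := le_antisymm (hξ L) h
    simp only [erase, Measure.sub_apply hA ((dirac_le_iff ξ.1 L).2 h)]
    by_cases hLA : L ∈ A
    · rw [Measure.dirac_apply_of_mem hLA, ← h1, ← Set.sdiff_eq,
        measure_sdiff (Set.singleton_subset_iff.2 hLA) hL.nullMeasurableSet (by simp [h1])]
    · rw [Measure.dirac_apply' L hA, Set.indicator_of_notMem hLA, tsub_zero, ← Set.sdiff_eq,
        Set.sdiff_singleton_eq_self hLA]

lemma singleton_erase_le {ξ : Conf d} (hξ : ∀ L, ξ.1 {L} ≤ 1) (K L : Particle d) :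
    (erase ξ K).1 {L} ≤ 1 :=
  (Measure.sub_le {L}).trans (hξ L)

lemma eraseAll_eq_restrict {ξ : Conf d} (hξ : ∀ L, ξ.1 {L} ≤ 1) (K : Fin p → Particle d) :
    (eraseAll ξ K).1 = ξ.1.restrict (Set.range K)ᶜ := by
  have h : ∀ (l : List (Particle d)) (ξ : Conf d), (∀ L, ξ.1 {L} ≤ 1) →
      (l.foldl erase ξ).1 = ξ.1.restrict {L | L ∈ l}ᶜ := by
    intro l
    induction l with
    | nil => intro ξ _; simp
    | cons a l ih =>
      intro ξ hξ
      have hl : MeasurableSet {L | L ∈ l}ᶜ := (List.finite_toSet l).measurableSet.compl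
      rw [List.foldl_cons, ih _ (singleton_erase_le hξ a), erase_eq_restrict hξ,
        Measure.restrict_restrict hl]
      congr 1
      ext L
      simp only [Set.mem_inter_iff, Set.mem_compl_iff, Set.mem_ofPred_eq, Set.mem_singleton_iff,
        List.mem_cons]
      tauto
  rw [eraseAll, h _ ξ hξ]
  congr 2
  ext L
  simp [List.mem_ofFn]

/-- The configuration `ζ + δ_{K₁} + … + δ_{K_p}`. -/
def insertAll (ζ : Conf d) (K : Fin p → Particle d) : Conf d :=
  ⟨ζ.1 + ∑ i, Measure.dirac (K i), ζ.2.add (isConf_sum_dirac _ _)⟩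

lemma measurable_insertAll :
    Measurable fun q : (Fin p → Particle d) × Conf d => insertAll q.2 q.1 := by
  refine measurable_conf_of_apply fun A hA => ?_
  simp only [insertAll, Measure.add_apply, Measure.finsetSum_apply, Measure.dirac_apply' _ hA]
  refine ((measurable_conf_apply hA).comp measurable_snd).add
    (Finset.measurable_sum _ fun i _ => ?_)
  exact (measurable_one.indicator hA).comp ((measurable_pi_apply i).comp measurable_fst)

lemma measurableSet_injective :
    MeasurableSet {K : Fin p → Particle d | Function.Injective K} := by
  have h : {K : Fin p → Particle d | Function.Injective K} = ⋂ i, ⋂ j, {K | K i = K j → i = j} := by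
    ext K; simp [Function.Injective]
  rw [h]
  refine MeasurableSet.iInter fun i => MeasurableSet.iInter fun j => ?_
  by_cases h : i = j
  · simp [h]
  · simp only [h, imp_false]
    exact (measurableSet_eq_fun (measurable_pi_apply i) (measurable_pi_apply j)).compl

/-- A configuration is carried by its atoms. -/
lemma ae_one_le_singleton {ξ : Conf d} (hξ : ∀ t, ξ.1 {K | radius K = t} ≤ 1) :
    ∀ᵐ L ∂ξ.1, 1 ≤ ξ.1 {L} := by
  rw [ae_iff]
  have h : {L : Particle d | ¬ 1 ≤ ξ.1 {L}} =
      ⋃ n : ℕ, {L | ¬ 1 ≤ ξ.1 {L}} ∩ {L | radius L ≤ n} := by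
    rw [← Set.inter_iUnion, iUnion_radius_le, Set.inter_univ]
  rw [h]
  refine measure_iUnion_null fun n => ?_
  obtain ⟨s, -, hs⟩ := exists_finset_of_radius_le_one hξ n
  rw [← Measure.restrict_apply' (measurableSet_radius_le _), hs, Measure.finsetSum_apply]
  refine Finset.sum_eq_zero fun K hK => ?_
  have h1 : 1 ≤ ξ.1 {K} :=
    calc (1 : ℝ≥0∞) = Measure.dirac K {K} := by simp
      _ ≤ ∑ L ∈ s, Measure.dirac L {K} :=
          Finset.single_le_sum (f := fun L => (Measure.dirac L {K} : ℝ≥0∞)) (fun _ _ => zero_le) hK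
      _ = ξ.1.restrict {K | radius K ≤ n} {K} := by rw [hs, Measure.finsetSum_apply]
      _ ≤ ξ.1 {K} := Measure.restrict_apply_le _ _
  rw [Measure.dirac_apply, Set.indicator_of_notMem]
  simpa using h1

/-- Tuples of different points can be removed and put back. -/
lemma ae_insertAll_eraseAll {ξ : Conf d} (hξ : ∀ t, ξ.1 {K | radius K = t} ≤ 1) :
    ∀ᵐ K ∂(factorialMeasure p ξ), insertAll (eraseAll ξ K) K = ξ := by
  have := isConf_sigmaFinite ξ
  have hatom : ∀ᵐ K ∂(Measure.pi fun _ : Fin p => ξ.1), ∀ i, 1 ≤ ξ.1 {K i} := by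
    refine ae_all_iff.2 fun i => ?_
    exact (Measure.tendsto_eval_ae_ae (μ := fun _ : Fin p => ξ.1) (i := i)).eventually
      (ae_one_le_singleton hξ)
  filter_upwards [ae_restrict_of_ae hatom, ae_restrict_mem measurableSet_injective] with K hK hinj
  have hs := singleton_le_of_radius hξ
  refine Subtype.ext ?_
  have hrange : MeasurableSet (Set.range K) := (Set.finite_range K).measurableSet
  have h1 : ξ.1.restrict (Set.range K) = ∑ i, Measure.dirac (K i) := by
    have hU : Set.range K = ⋃ i, {K i} := by ext; simp [eq_comm]
    rw [hU, Measure.restrict_iUnion (fun i j hij => by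
      simpa using fun h => hij (hinj h)) fun i => measurableSet_singleton _, Measure.sum_fintype]
    refine Finset.sum_congr rfl fun i _ => ?_
    rw [Measure.restrict_singleton, le_antisymm (hs (K i)) (hK i), one_smul]
  simp only [insertAll]
  rw [eraseAll_eq_restrict hs, ← h1, add_comm, Measure.restrict_add_restrict_compl hrange]

/-- Both sides are sums over all tuples of `p + 1` different points of `ξ`. -/
lemma lintegral_factorial_swap {ξ : Conf d} (hξ : ∀ L, ξ.1 {L} ≤ 1)
    {G : (Fin p → Particle d) → Particle d × Conf d → ℝ≥0∞} (hG : Measurable (Function.uncurry G)) :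
    ∫⁻ K, ∫⁻ L, G K (L, erase (eraseAll ξ K) L) ∂(eraseAll ξ K).1 ∂(factorialMeasure p ξ) =
      ∫⁻ L, ∫⁻ K, G K (L, eraseAll (erase ξ L) K) ∂(factorialMeasure p (erase ξ L)) ∂ξ.1 := by
  have := isConf_sigmaFinite ξ
  have hsf : SigmaFinite (factorialMeasure p ξ) := by unfold factorialMeasure; infer_instance
  have hcomm : ∀ (K : Fin p → Particle d) (L : Particle d),
      erase (eraseAll ξ K) L = eraseAll (erase ξ L) K := fun K L => by
    refine Subtype.ext ?_
    have h1 : ∀ M, (eraseAll ξ K).1 {M} ≤ 1 := fun M => by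
      rw [eraseAll_eq_restrict hξ]
      exact (Measure.restrict_apply_le _ _).trans (hξ M)
    rw [erase_eq_restrict h1, eraseAll_eq_restrict hξ,
      eraseAll_eq_restrict (singleton_erase_le hξ L), erase_eq_restrict hξ,
      Measure.restrict_restrict (measurableSet_singleton L).compl,
      Measure.restrict_restrict (Set.finite_range K).measurableSet.compl, Set.inter_comm]
  have hrange : MeasurableSet {q : (Fin p → Particle d) × Particle d | q.2 ∉ Set.range q.1} := by
    have h : {q : (Fin p → Particle d) × Particle d | q.2 ∉ Set.range q.1} =
        ⋂ i, {q | q.1 i = q.2}ᶜ := by ext; simp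
    rw [h]
    refine MeasurableSet.iInter fun i => (measurableSet_eq_fun ?_ measurable_snd).compl
    exact (measurable_pi_apply i).comp measurable_fst
  let H : (Fin p → Particle d) × Particle d → ℝ≥0∞ := Set.indicator {q | q.2 ∉ Set.range q.1}
    fun q => G q.1 (q.2, eraseAll (erase ξ q.2) q.1)
  have hH : Measurable H := by
    refine Measurable.indicator ?_ hrange
    have h2 : Measurable fun q : (Fin p → Particle d) × Particle d =>
        eraseAll (erase ξ q.2) q.1 :=
      measurable_eraseAll_comp (measurable_erase_comp measurable_const measurable_snd)
        measurable_fst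
    have h3 := hG.comp (measurable_fst.prodMk (measurable_snd.prodMk h2))
    simpa only [Function.comp_def, Function.uncurry] using h3
  calc ∫⁻ K, ∫⁻ L, G K (L, erase (eraseAll ξ K) L) ∂(eraseAll ξ K).1 ∂(factorialMeasure p ξ)
      = ∫⁻ K, ∫⁻ L, H (K, L) ∂ξ.1 ∂(factorialMeasure p ξ) := by
        refine lintegral_congr fun K => ?_
        rw [eraseAll_eq_restrict hξ,
          ← lintegral_indicator (Set.finite_range K).measurableSet.compl]
        refine lintegral_congr fun L => ?_
        by_cases hL : L ∈ Set.range K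
        · simp only [H]
          rw [Set.indicator_of_notMem (by simpa using hL),
            Set.indicator_of_notMem (by simpa using hL)]
        · simp only [H]
          rw [Set.indicator_of_mem (by simpa using hL),
            Set.indicator_of_mem (by simpa using hL), hcomm]
    _ = ∫⁻ L, ∫⁻ K, H (K, L) ∂(factorialMeasure p ξ) ∂ξ.1 :=
        lintegral_lintegral_swap (f := fun K L => H (K, L)) hH.aemeasurable
    _ = _ := by
        refine lintegral_congr fun L => ?_
        have hpi : MeasurableSet (Set.univ.pi fun _ : Fin p => ({L}ᶜ : Set (Particle d))) :=
          MeasurableSet.univ_pi fun _ => (measurableSet_singleton L).compl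
        have h1 : factorialMeasure p (erase ξ L) =
            (factorialMeasure p ξ).restrict (Set.univ.pi fun _ => {L}ᶜ) := by
          simp only [factorialMeasure]
          rw [erase_eq_restrict hξ, ← Measure.restrict_pi_pi,
            Measure.restrict_restrict measurableSet_injective, Measure.restrict_restrict hpi,
            Set.inter_comm]
        rw [h1, ← lintegral_indicator hpi]
        refine lintegral_congr fun K => ?_
        have hiff : K ∈ (Set.univ.pi fun _ : Fin p => ({L}ᶜ : Set (Particle d))) ↔
            L ∉ Set.range K := by simp [Set.mem_pi]
        by_cases hL : L ∈ Set.range K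
        · simp only [H]
          rw [Set.indicator_of_notMem (by simpa using hL),
            Set.indicator_of_notMem (fun h => hiff.1 h hL)]
        · simp only [H]
          rw [Set.indicator_of_mem (by simpa using hL), Set.indicator_of_mem (hiff.2 hL)]

end Simple

/-! ### The GNZ equation for reduced Palm distributions -/

section Palm

variable {d p : ℕ}

/-- The kernel `R` disintegrates the `p`-th Campbell measure of the law `P` with respect to the
factorial moment measure `α`. -/
def Disintegrates (P : Measure (Conf d)) (α : Measure (Fin p → Particle d))
    (R : Kernel (Fin p → Particle d) (Conf d)) : Prop :=
  ∀ f : (Fin p → Particle d) × Conf d → ℝ≥0∞, Measurable f →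
    ∫⁻ ξ, ∫⁻ K, f (K, ξ) ∂(factorialMeasure p ξ) ∂P = ∫⁻ K, ∫⁻ ξ, f (K, ξ) ∂(R K) ∂α

/-- The factorial moment measure is σ-finite as soon as Palm distributions exist: by Markov's
inequality, tuples in a ball for which the Palm distribution does not put too many points into this
ball form a set of finite measure. -/
lemma Disintegrates.sigmaFinite {P : Measure (Conf d)} [IsProbabilityMeasure P]
    {α : Measure (Fin p → Particle d)} {R : Kernel (Fin p → Particle d) (Conf d)}
    [IsMarkovKernel R] (h : Disintegrates P α R) : SigmaFinite α := by
  let B : ℕ → Set (Fin p → Particle d) := fun n =>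
    Set.univ.pi fun _ => Metric.closedBall {0} (n : ℝ)
  have hB : ∀ n, MeasurableSet (B n) := fun n => measurableSet_pi_closedBall p {0} n
  let N : ℕ → ℕ → Set (Conf d) := fun n m => {ξ | ξ.1 {K | radius K ≤ n} ≤ m}
  have hN : ∀ n m, MeasurableSet (N n m) := fun n m =>
    measurableSet_le (measurable_conf_apply (measurableSet_radius_le _)) measurable_const
  let S : ℕ → ℕ → Set (Fin p → Particle d) := fun n m => {K | K ∈ B n ∧ 2⁻¹ ≤ R K (N n m)}
  have hRm : ∀ n m, Measurable fun K => R K (N n m) := fun n m => R.measurable_coe (hN n m)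
  have hS : ∀ n m, α (S n m) < ∞ := fun n m => by
    have hf := h (Set.indicator (B n ×ˢ N n m) 1) (measurable_one.indicator ((hB n).prod (hN n m)))
    have hR : ∀ K, ∫⁻ ξ, Set.indicator (B n ×ˢ N n m) 1 (K, ξ) ∂(R K) =
        (B n).indicator (fun K => R K (N n m)) K := fun K => by
      by_cases hK : K ∈ B n
      · rw [Set.indicator_of_mem hK, ← lintegral_indicator_one (hN n m)]
        refine lintegral_congr fun ξ => ?_
        by_cases hξ : ξ ∈ N n m <;> simp [Set.indicator, hK, hξ]
      · simp [Set.indicator, hK]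
    have hP : ∀ ξ, ∫⁻ K, Set.indicator (B n ×ˢ N n m) 1 (K, ξ) ∂(factorialMeasure p ξ) ≤
        (m : ℝ≥0∞) ^ p := fun ξ => by
      by_cases hξ : ξ ∈ N n m
      · calc ∫⁻ K, Set.indicator (B n ×ˢ N n m) 1 (K, ξ) ∂(factorialMeasure p ξ)
            = factorialMeasure p ξ (B n) := by
              rw [← lintegral_indicator_one (hB n)]
              refine lintegral_congr fun K => ?_
              by_cases hK : K ∈ B n <;> simp [Set.indicator, hK, hξ]
          _ ≤ ξ.1 {K | radius K ≤ n} ^ p := factorialMeasure_closedBall_le ξ {0} n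
          _ ≤ (m : ℝ≥0∞) ^ p := by gcongr; exact hξ
      · simp [Set.indicator, hξ]
    have hle : ∫⁻ K, (B n).indicator (fun K => R K (N n m)) K ∂α ≤ (m : ℝ≥0∞) ^ p := by
      calc ∫⁻ K, (B n).indicator (fun K => R K (N n m)) K ∂α
          = ∫⁻ ξ, ∫⁻ K, Set.indicator (B n ×ˢ N n m) 1 (K, ξ) ∂(factorialMeasure p ξ) ∂P := by
            rw [hf]; exact lintegral_congr fun K => (hR K).symm
        _ ≤ ∫⁻ _ξ : Conf d, (m : ℝ≥0∞) ^ p ∂P := lintegral_mono hP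
        _ = (m : ℝ≥0∞) ^ p := by simp
    have hmarkov := mul_meas_ge_le_lintegral (μ := α) ((hRm n m).indicator (hB n)) 2⁻¹
    have hsub : S n m ⊆ {K | 2⁻¹ ≤ (B n).indicator (fun K => R K (N n m)) K} := fun K hK => by
      simp only [Set.mem_ofPred_eq, Set.indicator_of_mem hK.1]
      exact hK.2
    have h1 : 2⁻¹ * α (S n m) < ∞ :=
      ((mul_le_mul_right (measure_mono hsub) _).trans (hmarkov.trans hle)).trans_lt
        (ENNReal.pow_lt_top (ENNReal.natCast_lt_top m))
    rcases ENNReal.mul_lt_top_iff.1 h1 with h2 | h2 | h2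
    · exact h2.2
    · simp at h2
    · simp [h2]
  refine ⟨⟨⟨fun i => S i.unpair.1 i.unpair.2, fun _ => trivial, fun i => hS _ _, ?_⟩⟩⟩
  refine Set.eq_univ_of_forall fun K => ?_
  obtain ⟨n, hn⟩ := Set.mem_iUnion.1 ((iUnion_pi_closedBall p ({0} : Particle d)).symm ▸
    Set.mem_univ K)
  have hlim : Filter.Tendsto (fun m => R K (N n m)) Filter.atTop (nhds 1) := by
    have hmono : Monotone (N n) := fun a b hab ξ hξ =>
      le_trans (show ξ.1 {K | radius K ≤ n} ≤ a from hξ) (by exact_mod_cast hab)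
    have hU : ⋃ m, N n m = Set.univ := Set.eq_univ_of_forall fun ξ => by
      obtain ⟨m, hm⟩ := ENNReal.exists_nat_gt (conf_radius_lt_top ξ n).ne
      exact Set.mem_iUnion.2 ⟨m, hm.le⟩
    have h2 := tendsto_measure_iUnion_atTop (μ := R K) hmono
    rwa [hU, measure_univ] at h2
  obtain ⟨m, hm⟩ := (hlim.eventually (lt_mem_nhds
    (show (2⁻¹ : ℝ≥0∞) < 1 from ENNReal.inv_lt_one.2 ENNReal.one_lt_two))).exists
  refine Set.mem_iUnion.2 ⟨Nat.pair n m, ?_⟩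
  simp only [Nat.unpair_pair]
  exact ⟨hn, hm.le⟩

lemma lintegral_reducedPalm (R : Kernel (Fin p → Particle d) (Conf d)) (K : Fin p → Particle d)
    {h : Conf d → ℝ≥0∞} (hh : Measurable h) :
    ∫⁻ ζ, h ζ ∂(reducedPalm R K) = ∫⁻ ξ, h (eraseAll ξ K) ∂(R K) :=
  lintegral_map hh (measurable_eraseAll K)

lemma measurable_lintegral_reducedPalm (R : Kernel (Fin p → Particle d) (Conf d))
    [IsMarkovKernel R] {H : (Fin p → Particle d) × Conf d → ℝ≥0∞} (hH : Measurable H) :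
    Measurable fun K => ∫⁻ ζ, H (K, ζ) ∂(reducedPalm R K) := by
  have h1 : ∀ K, ∫⁻ ζ, H (K, ζ) ∂(reducedPalm R K) = ∫⁻ ξ, H (K, eraseAll ξ K) ∂(R K) := fun K =>
    lintegral_reducedPalm R K (hH.comp measurable_prodMk_left)
  simp only [h1]
  exact Measurable.lintegral_kernel_prod_right' (κ := R)
    (f := fun q : (Fin p → Particle d) × Conf d => H (q.1, eraseAll q.2 q.1))
    (hH.comp (measurable_fst.prodMk measurable_eraseAll_joint))

/-- The defining equation of reduced Palm distributions. -/
lemma Disintegrates.setLIntegral_reducedPalm {P : Measure (Conf d)}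
    {α : Measure (Fin p → Particle d)} {R : Kernel (Fin p → Particle d) (Conf d)}
    (h : Disintegrates P α R) {s : Set (Fin p → Particle d)} (hs : MeasurableSet s)
    {H : (Fin p → Particle d) × Conf d → ℝ≥0∞} (hH : Measurable H) :
    ∫⁻ K in s, ∫⁻ ζ, H (K, ζ) ∂(reducedPalm R K) ∂α =
      ∫⁻ ξ, ∫⁻ K, s.indicator 1 K * H (K, eraseAll ξ K) ∂(factorialMeasure p ξ) ∂P := by
  have h1 := h (fun q => s.indicator 1 q.1 * H (q.1, eraseAll q.2 q.1))
    (((measurable_one.indicator hs).comp measurable_fst).mul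
      (hH.comp (measurable_fst.prodMk measurable_eraseAll_joint)))
  simp only at h1
  rw [h1, ← lintegral_indicator hs]
  refine lintegral_congr fun K => ?_
  by_cases hK : K ∈ s
  · rw [Set.indicator_of_mem hK,
      lintegral_reducedPalm R K (h := fun ζ => H (K, ζ)) (hH.comp measurable_prodMk_left)]
    simp [hK]
  · simp [hK]

/-- The Papangelou intensity of the reduced Palm process at `K`. -/
def palmIntensity (κ : Particle d × Conf d → ℝ≥0∞) (K : Fin p → Particle d)
    (q : Particle d × Conf d) : ℝ≥0∞ :=
  κ (q.1, insertAll q.2 K)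

lemma measurable_palmIntensity_joint {κ : Particle d × Conf d → ℝ≥0∞} (hκm : Measurable κ) :
    Measurable fun r : ((Fin p → Particle d) × Conf d) × Particle d =>
      palmIntensity κ r.1.1 (r.2, r.1.2) := by
  have h := hκm.comp (measurable_snd.prodMk (measurable_insertAll.comp measurable_fst) :
    Measurable fun r : ((Fin p → Particle d) × Conf d) × Particle d =>
      (r.2, insertAll r.1.2 r.1.1))
  exact h

lemma measurable_palmIntensity {κ : Particle d × Conf d → ℝ≥0∞} (hκm : Measurable κ)
    (K : Fin p → Particle d) : Measurable (palmIntensity κ K) :=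
  (measurable_palmIntensity_joint hκm).comp
    ((measurable_const.prodMk measurable_snd).prodMk measurable_fst)

lemma measurable_lintegral_erase {f : Particle d × Conf d → ℝ≥0∞} (hf : Measurable f) :
    Measurable fun q : (Fin p → Particle d) × Conf d => ∫⁻ L, f (L, erase q.2 L) ∂q.2.1 := by
  refine measurable_lintegral_conf measurable_snd (f := fun q L => f (L, erase q.2 L)) ?_
  exact hf.comp (measurable_snd.prodMk
    (measurable_erase_comp (measurable_snd.comp measurable_fst) measurable_snd))

lemma measurable_lintegral_palmIntensity {κ : Particle d × Conf d → ℝ≥0∞} (hκm : Measurable κ)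
    (ν : Measure (Particle d)) [SFinite ν] {f : Particle d × Conf d → ℝ≥0∞} (hf : Measurable f) :
    Measurable fun q : (Fin p → Particle d) × Conf d =>
      ∫⁻ L, f (L, q.2) * palmIntensity κ q.1 (L, q.2) ∂ν :=
  Measurable.lintegral_prod_right' (f := fun r : ((Fin p → Particle d) × Conf d) × Particle d =>
    f (r.2, r.1.2) * palmIntensity κ r.1.1 (r.2, r.1.2))
    ((hf.comp (measurable_snd.prodMk (measurable_snd.comp measurable_fst))).mul
      (measurable_palmIntensity_joint hκm))

/-- The GNZ equation of the reduced Palm processes, integrated over `K`. It follows from the GNZ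
equation of `P` for the function that sums `f` over the tuples of points of a configuration. -/
lemma IsGNZ.setLIntegral_palm {P : Measure (Conf d)}
    {κ : Particle d × Conf d → ℝ≥0∞} (hκm : Measurable κ) (hκ : ∀ q, κ q ≤ 1)
    {ν : Measure (Particle d)} (hν : RadiallyDiffuse ν) (hP : IsGNZ P κ ν)
    {α : Measure (Fin p → Particle d)} {R : Kernel (Fin p → Particle d) (Conf d)}
    (h : Disintegrates P α R) {f : Particle d × Conf d → ℝ≥0∞} (hf : Measurable f)
    {s : Set (Fin p → Particle d)} (hs : MeasurableSet s) :
    ∫⁻ K in s, ∫⁻ ζ, ∫⁻ L, f (L, erase ζ L) ∂ζ.1 ∂(reducedPalm R K) ∂α =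
      ∫⁻ K in s, ∫⁻ ζ, ∫⁻ L, f (L, ζ) * palmIntensity κ K (L, ζ) ∂ν ∂(reducedPalm R K) ∂α := by
  have := hν.sigmaFinite
  have hs1 : Measurable (s.indicator 1 : (Fin p → Particle d) → ℝ≥0∞) := measurable_one.indicator hs
  have hA := measurable_lintegral_erase (p := p) hf
  have hB := measurable_lintegral_palmIntensity (p := p) hκm ν hf
  let F : Particle d × Conf d → ℝ≥0∞ := fun q =>
    ∫⁻ K, s.indicator 1 K * f (q.1, eraseAll q.2 K) ∂(factorialMeasure p q.2)
  have hEA : Measurable fun r : (Particle d × Conf d) × (Fin p → Particle d) =>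
      f (r.1.1, eraseAll r.1.2 r.2) :=
    hf.comp ((measurable_fst.comp measurable_fst).prodMk
      (measurable_eraseAll_comp (measurable_snd.comp measurable_fst) measurable_snd))
  have hF : Measurable F :=
    measurable_lintegral_factorial measurable_snd
      (f := fun q K => s.indicator 1 K * f (q.1, eraseAll q.2 K))
      ((hs1.comp measurable_snd).mul hEA)
  have hties := hP.ae_radius_le_one hκ hν
  rw [h.setLIntegral_reducedPalm hs hA, h.setLIntegral_reducedPalm hs hB]
  calc ∫⁻ ξ, ∫⁻ K, s.indicator 1 K * ∫⁻ L, f (L, erase (eraseAll ξ K) L) ∂(eraseAll ξ K).1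
        ∂(factorialMeasure p ξ) ∂P
      = ∫⁻ ξ, ∫⁻ L, F (L, erase ξ L) ∂ξ.1 ∂P := by
        refine lintegral_congr_ae ?_
        filter_upwards [hties] with ξ hξ
        have h1 := lintegral_factorial_swap (p := p) (singleton_le_of_radius hξ)
          (G := fun K q => s.indicator 1 K * f q) ((hs1.comp measurable_fst).mul
            (hf.comp measurable_snd))
        rw [← h1]
        refine lintegral_congr fun K => ?_
        rw [lintegral_const_mul]
        exact hf.comp (measurable_id.prodMk (measurable_erase_comp measurable_const measurable_id))
    _ = ∫⁻ ξ, ∫⁻ L, F (L, ξ) * κ (L, ξ) ∂ν ∂P := hP F hF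
    _ = _ := by
        refine lintegral_congr_ae ?_
        filter_upwards [hties] with ξ hξ
        have := isConf_sigmaFinite ξ
        have hsf : SigmaFinite (factorialMeasure p ξ) := by unfold factorialMeasure; infer_instance
        have hm1 : Measurable fun q : Particle d × (Fin p → Particle d) =>
            s.indicator 1 q.2 * f (q.1, eraseAll ξ q.2) :=
          (hs1.comp measurable_snd).mul (hEA.comp
            ((measurable_fst.prodMk measurable_const).prodMk measurable_snd))
        have hm2 : Measurable fun L => κ (L, ξ) := hκm.comp measurable_prodMk_right
        calc ∫⁻ L, F (L, ξ) * κ (L, ξ) ∂ν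
            = ∫⁻ L, ∫⁻ K, s.indicator 1 K * f (L, eraseAll ξ K) * κ (L, ξ)
                ∂(factorialMeasure p ξ) ∂ν := by
              refine lintegral_congr fun L => ?_
              rw [lintegral_mul_const]
              exact hm1.comp measurable_prodMk_left
          _ = ∫⁻ K, ∫⁻ L, s.indicator 1 K * f (L, eraseAll ξ K) * κ (L, ξ) ∂ν
                ∂(factorialMeasure p ξ) :=
              lintegral_lintegral_swap
                (f := fun L K => s.indicator 1 K * f (L, eraseAll ξ K) * κ (L, ξ))
                (hm1.mul (hm2.comp measurable_fst)).aemeasurable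
          _ = _ := by
              refine lintegral_congr_ae ?_
              filter_upwards [ae_insertAll_eraseAll (p := p) hξ] with K hK
              simp only [palmIntensity, hK, mul_assoc]
              rw [lintegral_const_mul]
              exact (hf.comp measurable_prodMk_right).mul hm2

/-- Almost every reduced Palm distribution satisfies the GNZ equation. -/
lemma IsGNZ.ae_palm {P : Measure (Conf d)} [IsProbabilityMeasure P]
    {κ : Particle d × Conf d → ℝ≥0∞} (hκm : Measurable κ) (hκ : ∀ q, κ q ≤ 1)
    {ν : Measure (Particle d)} (hν : RadiallyDiffuse ν) (hP : IsGNZ P κ ν)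
    {α : Measure (Fin p → Particle d)} {R : Kernel (Fin p → Particle d) (Conf d)}
    [IsMarkovKernel R] (h : Disintegrates P α R) :
    ∀ᵐ K ∂α, IsGNZ (reducedPalm R K) (palmIntensity κ K) ν := by
  have := hν.sigmaFinite
  have := h.sigmaFinite
  have hE : Measurable fun q : Conf d × Particle d => (q.2, erase q.1 q.2) :=
    measurable_snd.prodMk (measurable_erase_comp measurable_fst measurable_snd)
  have hae : ∀ f : Particle d × Conf d → ℝ≥0∞, Measurable f → ∀ᵐ K ∂α,
      ∫⁻ ζ, ∫⁻ L, f (L, erase ζ L) ∂ζ.1 ∂(reducedPalm R K) =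
        ∫⁻ ζ, ∫⁻ L, f (L, ζ) * palmIntensity κ K (L, ζ) ∂ν ∂(reducedPalm R K) := fun f hf => by
    exact ae_eq_of_forall_setLIntegral_eq_of_sigmaFinite
      (measurable_lintegral_reducedPalm R (measurable_lintegral_erase hf))
      (measurable_lintegral_reducedPalm R (measurable_lintegral_palmIntensity hκm ν hf))
      fun s hs _ => hP.setLIntegral_palm hκm hκ hν h hf hs
  -- it suffices to test the equation on a countable π-system
  obtain ⟨C, hC, hpi, huniv, hgen⟩ := exists_countable_isPiSystem (Particle d × Conf d)
  let t : ℕ → Set (Particle d × Conf d) := fun N => {q | radius q.1 ≤ N}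
  have ht : ∀ N, MeasurableSet (t N) := fun N => measurable_fst (measurableSet_radius_le _)
  have hCm : ∀ c ∈ C, MeasurableSet c := fun c hc => by
    rw [hgen]; exact MeasurableSpace.measurableSet_generateFrom hc
  have hall : ∀ᵐ K ∂α, ∀ c ∈ C, ∀ N,
      ∫⁻ ζ, ∫⁻ L, (c ∩ t N).indicator 1 (L, erase ζ L) ∂ζ.1 ∂(reducedPalm R K) =
        ∫⁻ ζ, ∫⁻ L, (c ∩ t N).indicator 1 (L, ζ) * palmIntensity κ K (L, ζ) ∂ν
          ∂(reducedPalm R K) := by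
    refine (ae_ball_iff hC).2 fun c hc => ae_all_iff.2 fun N => hae _ ?_
    exact measurable_one.indicator ((hCm c hc).inter (ht N))
  filter_upwards [hall] with K hK
  have hprob : IsProbabilityMeasure (reducedPalm R K) :=
    Measure.isProbabilityMeasure_map (measurable_eraseAll K).aemeasurable
  have hκK := measurable_palmIntensity hκm K
  let M₁ : Measure (Particle d × Conf d) :=
    (reducedPalm R K ⊗ₘ confKernel d).map fun q => (q.2, erase q.1 q.2)
  let M₂ : Measure (Particle d × Conf d) :=
    (ν.prod (reducedPalm R K)).withDensity (palmIntensity κ K)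
  have hM₁ : ∀ f : Particle d × Conf d → ℝ≥0∞, Measurable f →
      ∫⁻ q, f q ∂M₁ = ∫⁻ ζ, ∫⁻ L, f (L, erase ζ L) ∂ζ.1 ∂(reducedPalm R K) := fun f hf => by
    rw [lintegral_map hf hE,
      Measure.lintegral_compProd (f := fun q => f (q.2, erase q.1 q.2)) (hf.comp hE)]
    rfl
  have hM₂ : ∀ f : Particle d × Conf d → ℝ≥0∞, Measurable f → ∫⁻ q, f q ∂M₂ =
      ∫⁻ ζ, ∫⁻ L, f (L, ζ) * palmIntensity κ K (L, ζ) ∂ν ∂(reducedPalm R K) := fun f hf => by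
    rw [lintegral_withDensity_eq_lintegral_mul _ hκK hf,
      lintegral_prod_symm _ (hκK.mul hf).aemeasurable]
    simp only [Pi.mul_apply, mul_comm]
  have hMeq : ∀ c ∈ C, ∀ N, M₁ (c ∩ t N) = M₂ (c ∩ t N) := fun c hc N => by
    have hm := (hCm c hc).inter (ht N)
    rw [← lintegral_indicator_one hm, ← lintegral_indicator_one hm,
      hM₁ _ (measurable_one.indicator hm), hM₂ _ (measurable_one.indicator hm)]
    exact hK c hc N
  have hMt : ∀ N, M₁ (t N) = M₂ (t N) := fun N => by simpa using hMeq _ huniv N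
  have hM : M₁ = M₂ := by
    refine Measure.ext_of_generateFrom_of_cover (S := C) (T := Set.range t) hgen
      (Set.countable_range t) hpi ?_ ?_ ?_ ?_
    · refine Set.eq_univ_of_forall fun q => ?_
      obtain ⟨N, hN⟩ := exists_nat_ge (radius q.1)
      exact ⟨t N, ⟨N, rfl⟩, hN⟩
    · rintro _ ⟨N, rfl⟩
      rw [hMt, withDensity_apply _ (ht N)]
      refine ne_top_of_le_ne_top (hν.finite N).ne ?_
      calc ∫⁻ q in t N, palmIntensity κ K q ∂(ν.prod (reducedPalm R K))
          ≤ ∫⁻ _q in t N, 1 ∂(ν.prod (reducedPalm R K)) := lintegral_mono fun q => hκ _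
        _ = (ν.prod (reducedPalm R K)) ({L | radius L ≤ N} ×ˢ Set.univ) := by
            rw [setLIntegral_one]
            congr 1
            ext q; simp [t]
        _ = ν {L | radius L ≤ N} := by rw [Measure.prod_prod, measure_univ, mul_one]
    · rintro _ ⟨N, rfl⟩ c hc
      exact hMeq c hc N
    · rintro _ ⟨N, rfl⟩
      exact hMt N
  intro f hf
  rw [← hM₁ f hf, ← hM₂ f hf, hM]

end Palm

/-! ### The intensity measure of a stationary particle process is radially diffuse -/

section Stationary

variable {d : ℕ}

lemma norm_le_radius {K : Particle d} {y : Euc d} (hy : y ∈ K) : ‖y‖ ≤ radius K := by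
  have h := Metric.infDist_le_hausdorffDist_of_mem (s := (K : Set (Euc d)))
    (t := (({0} : Particle d) : Set (Euc d))) hy
    (Metric.hausdorffEDist_ne_top_of_nonempty_of_bounded K.nonempty
      ({0} : Particle d).nonempty K.isCompact.isBounded ({0} : Particle d).isCompact.isBounded)
  simpa [radius, Metric.NonemptyCompacts.dist_eq] using h

lemma radius_le {K : Particle d} {t : ℝ} (ht : 0 ≤ t) (h : ∀ y ∈ K, ‖y‖ ≤ t) :
    radius K ≤ t := by
  rw [radius, Metric.NonemptyCompacts.dist_eq]
  obtain ⟨y, hy⟩ := K.nonempty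
  refine Metric.hausdorffDist_le_of_mem_dist ht (fun x hx => ⟨0, by simp, by simpa using h x hx⟩)
    fun x hx => ⟨y, hy, ?_⟩
  have : x = 0 := by simpa using hx
  simpa [this] using h y hy

lemma mem_translate {K : Particle d} {x z : Euc d} :
    z ∈ translate K x ↔ ∃ y ∈ K, y + x = z := by
  rw [← SetLike.mem_coe, translate, NonemptyCompacts.coe_map]
  rfl

lemma radius_translate_le_iff {K : Particle d} {x : Euc d} {t : ℝ} (ht : 0 ≤ t) :
    radius (translate K x) ≤ t ↔ ∀ y ∈ K, ‖y + x‖ ≤ t := by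
  refine ⟨fun h y hy => (norm_le_radius (mem_translate.2 ⟨y, hy, rfl⟩)).trans h, fun h => ?_⟩
  refine radius_le ht fun z hz => ?_
  obtain ⟨y, hy, rfl⟩ := mem_translate.1 hz
  exact h y hy

/-- The set of translations for which the radius of `K + x` is `t` is Lebesgue null: for `t > 0`,
it lies in the boundary of the convex set `{x | K + x ⊆ B(0, t)}`. -/
lemma volume_radius_translate_eq (hd : 1 ≤ d) (K : Particle d) (t : ℝ) :
    (volume : Measure (Euc d)) {x | radius (translate K x) = t} = 0 := by
  rcases lt_trichotomy t 0 with ht | rfl | ht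
  · convert measure_empty (μ := (volume : Measure (Euc d)))
    exact Set.eq_empty_of_forall_notMem fun x hx =>
      absurd (radius_nonneg (translate K x)) (by rw [show radius _ = t from hx]; exact not_le.2 ht)
  · obtain ⟨y, hy⟩ := K.nonempty
    have : Nonempty (Fin d) := ⟨⟨0, hd⟩⟩
    refine measure_mono_null (t := {-y}) (fun x hx => ?_) (measure_singleton _)
    have h := (radius_translate_le_iff le_rfl).1 (le_of_eq hx) y hy
    have : y + x = 0 := norm_le_zero_iff.1 h
    exact (neg_eq_of_add_eq_zero_right this).symm
  · let S : Set (Euc d) := {x | ∀ y ∈ K, ‖y + x‖ ≤ t}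
    have hS : Convex ℝ S := by
      have : S = ⋂ y ∈ K, {x | ‖y + x‖ ≤ t} := by ext x; simp [S]
      rw [this]
      refine convex_iInter fun y => convex_iInter fun _ => ?_
      have : {x : Euc d | ‖y + x‖ ≤ t} = Metric.closedBall (-y) t := by
        ext x; simp [dist_eq_norm, add_comm]
      rw [this]
      exact convex_closedBall _ _
    refine measure_mono_null (fun x hx => ?_) (hS.addHaar_frontier volume)
    have hx' : radius (translate K x) = t := hx
    have hxS : x ∈ S := (radius_translate_le_iff ht.le).1 hx'.le
    -- at a point of `K` where `‖y + x‖` attains its maximum `t`, moving `x` outwards leaves `S`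
    obtain ⟨y, hy, hmax⟩ := K.isCompact.exists_isMaxOn K.nonempty
      (f := fun y : Euc d => ‖y + x‖) (by fun_prop)
    have hyt : ‖y + x‖ = t := by
      refine le_antisymm (hxS y hy) ?_
      rw [← hx']
      exact (radius_translate_le_iff (norm_nonneg _)).2 fun z hz => hmax hz
    rw [frontier, Set.mem_sdiff]
    refine ⟨subset_closure hxS, fun hint => ?_⟩
    have hc : Filter.Tendsto (fun δ : ℝ => x + δ • (y + x)) (nhds 0) (nhds x) := by
      have : Continuous fun δ : ℝ => x + δ • (y + x) := by fun_prop
      simpa using this.tendsto 0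
    have hev := hc.eventually (mem_interior_iff_mem_nhds.1 hint)
    obtain ⟨δ, hδ, hδ0⟩ := ((hev.filter_mono nhdsWithin_le_nhds).and
      (self_mem_nhdsWithin (s := Set.Ioi (0 : ℝ)))).exists
    have hδ0 : 0 < δ := hδ0
    have h := hδ y hy
    have he : y + (x + δ • (y + x)) = (1 + δ) • (y + x) := by module
    rw [he, norm_smul, hyt, Real.norm_of_nonneg (by linarith)] at h
    nlinarith

lemma particleMeasure_apply (Q : Measure (Particle d)) [IsProbabilityMeasure Q]
    {A : Set (Particle d)} (hA : MeasurableSet A) :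
    particleMeasure Q A = ∫⁻ K, (volume : Measure (Euc d)) {x | translate K x ∈ A} ∂Q := by
  rw [particleMeasure, Measure.map_apply measurable_translate hA,
    Measure.prod_apply (measurable_translate hA)]
  rfl

lemma RadiallyDiffuse.smul {ν : Measure (Particle d)} (h : RadiallyDiffuse ν) (c : ℝ≥0) :
    RadiallyDiffuse (c • ν) where
  finite t := by
    rw [Measure.smul_apply]
    exact ENNReal.mul_lt_top ENNReal.coe_lt_top (h.finite t)
  null t := by rw [Measure.smul_apply, h.null, smul_zero]

lemma radiallyDiffuse_particleMeasure (hd : 1 ≤ d) (Q : Measure (Particle d))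
    [IsProbabilityMeasure Q] {r : ℝ}
    (hQ : ∀ᵐ K : Particle d ∂Q, (K : Set (Euc d)) ⊆ Metric.closedBall 0 r) :
    RadiallyDiffuse (particleMeasure Q) where
  finite t := by
    rw [particleMeasure_apply Q (measurableSet_radius_le t)]
    calc ∫⁻ K, volume {x : Euc d | translate K x ∈ {K | radius K ≤ t}} ∂Q
        ≤ ∫⁻ _K, volume (Metric.closedBall (0 : Euc d) (t + r)) ∂Q := by
          refine lintegral_mono_ae ?_
          filter_upwards [hQ] with K hK
          refine measure_mono fun x hx => ?_
          have hx : radius (translate K x) ≤ t := hx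
          obtain ⟨y, hy⟩ := K.nonempty
          have h1 : ‖y + x‖ ≤ t := (norm_le_radius (mem_translate.2 ⟨y, hy, rfl⟩)).trans hx
          have h2 : ‖y‖ ≤ r := by simpa using hK hy
          rw [mem_closedBall_zero_iff]
          calc ‖x‖ = ‖(y + x) - y‖ := by rw [add_sub_cancel_left]
            _ ≤ ‖y + x‖ + ‖y‖ := norm_sub_le _ _
            _ ≤ t + r := add_le_add h1 h2
      _ = volume (Metric.closedBall (0 : Euc d) (t + r)) := by simp
      _ < ∞ := measure_closedBall_lt_top
  null t := by
    rw [particleMeasure_apply Q (measurableSet_radius_eq t)]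
    exact (lintegral_congr fun K => volume_radius_translate_eq hd K t).trans lintegral_zero

end Stationary

/-! ### Laws of Gibbs processes -/

section Gibbs

variable {d : ℕ} {Ω : Type*} [MeasurableSpace Ω] {P : Measure Ω} {Ξ : Ω → Conf d}

/-- The law of a Gibbs process satisfies the GNZ equation with the intensity `lam • μ`. -/
lemma IsGibbsProcess.isGNZ {κ : Particle d × Conf d → ℝ≥0} {lam : ℝ≥0}
    {μ : Measure (Particle d)} [SFinite μ] (h : IsGibbsProcess P Ξ κ lam μ) :
    IsGNZ (P.map Ξ) (fun q => (κ q : ℝ≥0∞)) (lam • μ) := by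
  intro f hf
  have hκ : Measurable fun q => (κ q : ℝ≥0∞) := h.measurable_papangelou.coe_nnreal_ennreal
  have hm : Measurable fun ξ : Conf d => ∫⁻ K, f (K, ξ) * κ (K, ξ) ∂(lam • μ) :=
    Measurable.lintegral_prod_left' (f := fun q : Particle d × Conf d => f q * κ q) (hf.mul hκ)
  have he : Measurable fun ξ : Conf d => ∫⁻ K, f (K, erase ξ K) ∂ξ.1 :=
    measurable_lintegral_conf measurable_id (f := fun ξ K => f (K, erase ξ K))
      (hf.comp (measurable_snd.prodMk (measurable_erase_comp measurable_fst measurable_snd)))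
  rw [lintegral_map he h.measurable, lintegral_map hm h.measurable,
    h.gnz f hf]
  have hm' : Measurable fun ξ : Conf d => ∫⁻ K, f (K, ξ) * κ (K, ξ) ∂μ :=
    Measurable.lintegral_prod_left' (f := fun q : Particle d × Conf d => f q * κ q) (hf.mul hκ)
  have hmΞ : Measurable fun ω => ∫⁻ K, f (K, Ξ ω) * κ (K, Ξ ω) ∂μ := hm'.comp h.measurable
  rw [← lintegral_const_mul _ hmΞ]
  refine lintegral_congr fun ω => ?_
  rw [lintegral_smul_measure]
  rfl

lemma IsPalm.disintegrates {p : ℕ} {R : Kernel (Fin p → Particle d) (Conf d)}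
    (hΞ : Measurable Ξ) (h : IsPalm P Ξ p R) :
    Disintegrates (P.map Ξ) (factorialMomentMeasure P Ξ p) R := by
  intro f hf
  have hm : Measurable fun ξ : Conf d => ∫⁻ K, f (K, ξ) ∂(factorialMeasure p ξ) :=
    measurable_lintegral_factorial measurable_id (f := fun ξ K => f (K, ξ))
      (hf.comp measurable_swap)
  rw [← h.2 f hf, lintegral_map hm hΞ]

end Gibbs

end ParticleProcess

end

open ParticleProcess in
theorem lemma2p4 {d : ℕ} (hd : 1 ≤ d)
    (Q : Measure (Particle d)) [IsProbabilityMeasure Q]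
    (r : ℝ) (hr : 0 < r) (hQ : ∀ᵐ K : Particle d ∂Q, (K : Set (Euc d)) ⊆ Metric.closedBall 0 r)
    (lam : ℝ≥0) (hlam : 0 < lam)
    (κ : Particle d × Conf d → ℝ≥0) (hκ : ∀ q, κ q ≤ 1)
    {Ω : Type*} [MeasurableSpace Ω] (P : Measure Ω) [IsProbabilityMeasure P] (Ξ : Ω → Conf d)
    (hΞ : IsGibbsProcess P Ξ κ lam (particleMeasure Q))
    {Ω' : Type*} [MeasurableSpace Ω'] (P' : Measure Ω') [IsProbabilityMeasure P']
    (X : Ω' → Conf d) (hX : IsPoissonProcess P' X (lam • particleMeasure Q)) :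
    StochDominated (P.map Ξ) (P'.map X) ∧
      ∀ (p : ℕ), 1 ≤ p → ∀ R : Kernel (Fin p → Particle d) (Conf d), IsPalm P Ξ p R →
        ∀ᵐ K ∂(factorialMomentMeasure P Ξ p), StochDominated (reducedPalm R K) (P'.map X) := by
  have hν₀ := radiallyDiffuse_particleMeasure hd Q hQ
  have hν := hν₀.smul lam
  have := hν₀.sigmaFinite
  have hκm : Measurable fun q => (κ q : ℝ≥0∞) := hΞ.measurable_papangelou.coe_nnreal_ennreal
  have hκ1 : ∀ q, (κ q : ℝ≥0∞) ≤ 1 := fun q => by exact_mod_cast hκ q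
  have hP : IsProbabilityMeasure (P.map Ξ) :=
    Measure.isProbabilityMeasure_map hΞ.measurable.aemeasurable
  have hgnz := hΞ.isGNZ
  refine ⟨hgnz.stochDominated hκm hκ1 hν hX, fun p _ R hR => ?_⟩
  have := hR.1
  filter_upwards [hgnz.ae_palm hκm hκ1 hν (hR.disintegrates hΞ.measurable)] with K hK
  have : IsProbabilityMeasure (reducedPalm R K) :=
    Measure.isProbabilityMeasure_map (measurable_eraseAll K).aemeasurable
  exact hK.stochDominated (measurable_palmIntensity hκm K) (fun q => hκ1 _) hν hX
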